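/- **Setting.** Let $(\Omega,\mathcal F,P)$ be a probability space with a filtration $(\mathcal F_n)_{n\ge 0}$, and let $\theta_n, Y_n$ be $\mathbb R^d$-valued $\mathcal F_n$-adapted processes with $$\theta_{n+1}=\theta_n+a(n)\,[f(\theta_n,Y_n)+M_{n+1}]\quad\text{a.s.},\qquad n\ge 0,$$ where $f:\mathbb R^d\times\mathbb R^d\to\mathbb R^d$ is measurable in its second variable, $(M_n)_{n\ge1}$ is an $\mathbb R^d$-valued martingale difference sequence for $(\mathcal F_n)$, and, for a family of Markov kernels $\Pi_\theta$ ($\theta\in\mathbb R^d$) on $\mathbb R^d$, $P[Y_{n+1}\in A\mid\mathcal F_n]=\Pi_{\theta_n}(Y_n;A)$ a.s. for all $n$ and all Borel $A$. Assume: * (A1) there is a constant $\bar C$ with $\limsup_n\|Y_n\|<\bar C$ a.s., and $\limsup_n E\|Y_n\|^2<\infty$; * (A2) there is $K$ with $\sup_y\|f(\theta,y)\|\le K(1+\|\theta\|)$ for all $\theta$; * (A3) the step sizes $a(n)$ are positive and non-increasing, $\sum_n a(n)=\infty$, $\sum_n a(n)^2<\infty$; * (A4) for every $\theta$, $\Pi_\theta$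 has a unique invariant probability $\Gamma_\theta$, and $h(\theta)=\int f(\theta,y)\,\Gamma_\theta(dy)$ is Lipschitz in $\theta$; * (A5) there is $K'$ with $\|M_{n+1}\|\le K'(1+\|\theta_n\|)$ a.s. for all $n$; * (A6) for every $\theta$ there is a measurable $v_\theta:\mathbb R^d\to\mathbb R^d$, integrable with respect to every $\Pi_\theta(y;\cdot)$, which solves the Poisson equation $v_\theta(y)-\int v_\theta(x)\,\Pi_\theta(y;dx)=f(\theta,y)-h(\theta)$ for all $y$; * (A7) for every $R>0$ there is $C_R>0$ such that $\|v_\theta(x)\|\le C_R(1+\|x\|)$ and $\|v_\theta(x)-v_{\theta'}(x)\|\le C_R\|\theta-\theta'\|(1+\|x\|)$ for all $x$ and all $\|\theta\|,\|\theta'\|\le R$. Let $G\subset\mathbb R^d$ be open and $V:G\to[0,\infty)$ differentiable with $\langle\nabla V,h\rangle\le 0$ on $G$, such that $H:=\{\theta\in G: V(\theta)=0\}$ is compact and equals $\{\theta\in G:\langle\nabla V(\theta),h(\theta)\rangle=0\}$. Let $B$ be open with compact closure and $H\subset B\subset\bar B\subset G$, and suppose that $\bar B$ lies in the domain of attraction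 of $H$, i.e. every solution $x:[0,\infty)\to\mathbb R^d$ of $\dot x=h(x)$ with $x(0)\in\bar B$ satisfies $\operatorname{dist}(x(t),H)\to0$ as $t\to\infty$. **Statement.** Suppose that * (W1) for every $N$ there is $n\ge N$ with $P(\theta_n\in B)>0$; * (W2) $\sum_{n=1}^\infty P(\theta_n\in B\mid\mathcal F_{n-1})=\infty$ a.s., and that, for all sufficiently large $n$, either $a(n)=1/n^k$ for a fixed real $k$ with $1/2<k\le1$, or $a(n)=1/(n(\log n)^k)$ for a fixed real $k\le1$. Then $\sup_n\|\theta_n\|<\infty$ a.s. and $\operatorname{dist}(\theta_n,H)\to0$ a.s. -/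

import Mathlib

open MeasureTheory ProbabilityTheory Filter Topology Set
open scoped NNReal ENNReal

/-- The averaged (mean) vector field `h(θ) = ∫ f(θ, y) Γ_θ(dy)`. -/
noncomputable def meanField {d : ℕ}
    (f : EuclideanSpace ℝ (Fin d) → EuclideanSpace ℝ (Fin d) → EuclideanSpace ℝ (Fin d))
    (Γ : EuclideanSpace ℝ (Fin d) → Measure (EuclideanSpace ℝ (Fin d)))
    (z : EuclideanSpace ℝ (Fin d)) : EuclideanSpace ℝ (Fin d) :=
  ∫ y, f z y ∂(Γ z)

/-- The domain of attraction of `H` for the autonomous equation `x' = h(x)`: the points `z` such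
that the forward solutions on `[0, ∞)` started at `z` have distance to `H` tending to zero.
(If `h` is globally Lipschitz there is exactly one such solution for each `z`.) -/
def domainOfAttraction {d : ℕ}
    (h : EuclideanSpace ℝ (Fin d) → EuclideanSpace ℝ (Fin d))
    (H : Set (EuclideanSpace ℝ (Fin d))) : Set (EuclideanSpace ℝ (Fin d)) :=
  {z | ∀ x : ℝ → EuclideanSpace ℝ (Fin d), x 0 = z →
    (∀ t ∈ Ici (0 : ℝ), HasDerivWithinAt x (h (x t)) (Ici 0) t) →
    Tendsto (fun t => Metric.infEDist (x t) H) atTop (𝓝 0)}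

/-- `H` is the zero set in the open set `G` of a strict Lyapunov function `V : G → [0, ∞)` for
`x' = h(x)`: `⟨∇V, h⟩ ≤ 0` on `G`, and
`H = {V = 0} = {⟨∇V, h⟩ = 0}` is compact. Only the values of `V` on `G` matter. -/
structure IsStrictLyapunov {d : ℕ} (V : EuclideanSpace ℝ (Fin d) → ℝ)
    (h : EuclideanSpace ℝ (Fin d) → EuclideanSpace ℝ (Fin d))
    (G H : Set (EuclideanSpace ℝ (Fin d))) : Prop where
  isOpen : IsOpen G
  nonneg : ∀ z ∈ G, 0 ≤ V z
  differentiableAt : ∀ z ∈ G, DifferentiableAt ℝ V z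
  inner_nonpos : ∀ z ∈ G, inner ℝ (gradient V z) (h z) ≤ 0
  eq_zero_set : H = {z ∈ G | V z = 0}
  eq_inner_zero_set : H = {z ∈ G | inner ℝ (gradient V z) (h z) = 0}
  isCompact : IsCompact H

/-- `M 1, M 2, …` is a martingale difference sequence for the filtration `ℱ`
(`M 0` plays no role). -/
structure IsMartingaleDifference {Ω : Type*} [MeasurableSpace Ω] {d : ℕ} (P : Measure Ω)
    (ℱ : Filtration ℕ ‹MeasurableSpace Ω›) (M : ℕ → Ω → EuclideanSpace ℝ (Fin d)) : Prop where
  stronglyMeasurable : ∀ n, StronglyMeasurable[ℱ (n + 1)] (M (n + 1))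
  integrable : ∀ n, Integrable (M (n + 1)) P
  condExp_eq_zero : ∀ n, P[M (n + 1) | ℱ n] =ᵐ[P] 0

/-- The step sizes are, from some index on, of the form `1 / n ^ k` with `1/2 < k ≤ 1`,
or of the form `1 / (n (log n) ^ k)` with `k ≤ 1` (`k` real). -/
def HasStepForm (a : ℕ → ℝ) : Prop :=
  (∃ k : ℝ, 1 / 2 < k ∧ k ≤ 1 ∧ ∀ᶠ n : ℕ in atTop, a n = 1 / (n : ℝ) ^ k) ∨
  (∃ k : ℝ, k ≤ 1 ∧ ∀ᶠ n : ℕ in atTop, a n = 1 / ((n : ℝ) * (Real.log n) ^ k))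

/-! By (W2) and Lévy's conditional Borel–Cantelli lemma, almost every path visits `B` infinitely
often. The rest is pathwise: if the noise accumulated while the iterates stay bounded is negligible,
one late visit to `B` already traps the path.

Noise. Write `h` for the mean field, Π for the kernel. By the Poisson equation, `f(θ_n, Y_n) -
h(θ_n)` is the sum of `v(θ_n, Y_n) - v(θ_n, Y_{n+1})` and the centred term `v(θ_n, Y_{n+1}) - ∫
v(θ_n, x) Π(dx)`. The first is summed by parts (`exists_forall_norm_sum_smul_poisson_le`). The
second, together with `M_{n+1}` and cut off to `‖θ_n‖ ≤ R`, is a martingale difference with bounded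
second moments, so its sum weighted by `a(n)` converges (`ae_exists_tendsto_sum_martingale_noise`).

Tracking. From a late visit to a bounded set, the iterates follow the ODE over any fixed time span
(`exists_forall_norm_sub_forwardSolution_le`). No a priori stability is needed: the ODE solution
itself confines the iterates to the ball where the noise estimate holds.

Dynamics. The Lyapunov function makes `H` stable, so compactness makes attraction from `closure B`
uniform in time (`IsStrictLyapunov.exists_uniform_time`). After a late visit to `B` the path is
therefore in `U ∩ B` throughout a later time window; restarting from there covers all later times
(`IsStrictLyapunov.eventually_mem_of_frequently_mem`). -/

/-- `x` solves `x' = h(x)` on `[0, ∞)`. -/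
def IsForwardSolution {E : Type*} [NormedAddCommGroup E] [NormedSpace ℝ E]
    (h : E → E) (x : ℝ → E) : Prop :=
  ∀ t ∈ Ici (0 : ℝ), HasDerivWithinAt x (h (x t)) (Ici 0) t

/-! ### Global solutions of a Lipschitz ODE. -/

section Flow

variable {E : Type*} [NormedAddCommGroup E] [NormedSpace ℝ E] {h : E → E} {L : ℝ≥0}

theorem IsForwardSolution.continuousOn {x : ℝ → E} (hx : IsForwardSolution h x) :
    ContinuousOn x (Ici 0) := fun t ht => (hx t ht).continuousWithinAt

theorem IsForwardSolution.hasDerivWithinAt_Ici {x : ℝ → E} (hx : IsForwardSolution h x)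
    {t : ℝ} (ht : 0 ≤ t) : HasDerivWithinAt x (h (x t)) (Ici t) t :=
  (hx t ht).mono (Ici_subset_Ici.2 ht)

theorem IsForwardSolution.shift {x : ℝ → E} (hx : IsForwardSolution h x) {s : ℝ} (hs : 0 ≤ s) :
    IsForwardSolution h (fun t => x (s + t)) := by
  intro t ht
  have h1 : HasDerivWithinAt (fun t : ℝ => s + t) 1 (Ici 0) t :=
    (hasDerivWithinAt_id t _).const_add s
  have h2 := (hx (s + t) (add_nonneg hs ht)).scomp t h1
    (fun u hu => add_nonneg hs hu)
  simpa [Function.comp_def] using h2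

theorem IsForwardSolution.dist_le {x y : ℝ → E} (hL : LipschitzWith L h)
    (hx : IsForwardSolution h x) (hy : IsForwardSolution h y) {t : ℝ} (ht : 0 ≤ t) :
    dist (x t) (y t) ≤ dist (x 0) (y 0) * Real.exp (L * t) := by
  have := dist_le_of_trajectories_ODE (v := fun _ => h) (a := 0) (b := t) (fun _ => hL)
    (hx.continuousOn.mono Icc_subset_Ici_self) (fun s hs => hx.hasDerivWithinAt_Ici hs.1)
    (hy.continuousOn.mono Icc_subset_Ici_self) (fun s hs => hy.hasDerivWithinAt_Ici hs.1)
    le_rfl t ⟨ht, le_rfl⟩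
  simpa using this

/-- The constant curve at `x 0` is an approximate solution with defect `‖h (x 0)‖`, so Grönwall
applies. The bound is uniform over starting points of bounded speed. -/
theorem IsForwardSolution.norm_sub_le {x : ℝ → E} (hL : LipschitzWith L h)
    (hx : IsForwardSolution h x) {c : ℝ} (hc : ‖h (x 0)‖ ≤ c) {t : ℝ} (ht : 0 ≤ t) :
    ‖x t - x 0‖ ≤ gronwallBound 0 L c t := by
  have := dist_le_of_approx_trajectories_ODE (v := fun _ => h) (a := 0) (b := t) (δ := 0)
    (f := x) (g := fun _ => x 0) (f' := fun s => h (x s)) (g' := fun _ => 0)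
    (εf := 0) (εg := c) (fun _ => hL)
    (hx.continuousOn.mono Icc_subset_Ici_self) (fun s hs => hx.hasDerivWithinAt_Ici hs.1)
    (fun s _ => by simp) continuousOn_const (fun s _ => hasDerivWithinAt_const _ _ _)
    (fun s _ => by simpa [dist_eq_norm] using hc) (by simp) t ⟨ht, le_rfl⟩
  simpa [dist_eq_norm] using this

theorem HasDerivWithinAt.glue_Icc {x y : ℝ → E} {b c : ℝ} (hb : 0 ≤ b) (hc : 0 ≤ c)
    (hx : ∀ t ∈ Icc 0 b, HasDerivWithinAt x (h (x t)) (Icc 0 b) t)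
    (hy : ∀ t ∈ Icc 0 c, HasDerivWithinAt y (h (y t)) (Icc 0 c) t) (hxy : y 0 = x b) :
    ∃ w : ℝ → E, w 0 = x 0 ∧
      ∀ t ∈ Icc 0 (b + c), HasDerivWithinAt w (h (w t)) (Icc 0 (b + c)) t := by
  classical
  let w : ℝ → E := fun t => if t ≤ b then x t else y (t - b)
  have w1 : EqOn w x (Icc 0 b) := fun t ht => if_pos ht.2
  have w2 : EqOn w (fun t => y (t - b)) (Icc b (b + c)) := by
    intro t ht
    by_cases h' : t ≤ b
    · have : t = b := le_antisymm h' ht.1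
      simp [w, this, hxy]
    · exact if_neg h'
  refine ⟨w, w1 (left_mem_Icc.2 hb), fun t ht => ?_⟩
  rw [← Icc_union_Icc_eq_Icc hb (by linarith : b ≤ b + c)]
  refine HasDerivWithinAt.union ?_ ?_
  · by_cases h' : t ∈ Icc 0 b
    · rw [w1 h']
      exact (hx t h').congr w1 (w1 h')
    · exact HasFDerivWithinAt.of_notMem_closure (by rwa [isClosed_Icc.closure_eq])
  · by_cases h' : t ∈ Icc b (b + c)
    · rw [w2 h']
      refine HasDerivWithinAt.congr ?_ w2 (w2 h')
      have h1 : HasDerivWithinAt (fun t : ℝ => t - b) 1 (Icc b (b + c)) t :=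
        (hasDerivWithinAt_id t _).sub_const b
      have h2 := (hy (t - b) ⟨by linarith [h'.1], by linarith [h'.2]⟩).scomp t h1
        (t' := Icc 0 c)
        (fun u hu => ⟨by linarith [hu.1], by linarith [hu.2]⟩)
      simpa [Function.comp_def] using h2
    · exact HasFDerivWithinAt.of_notMem_closure (by rwa [isClosed_Icc.closure_eq])

variable [CompleteSpace E]

/-- On the ball of radius `‖h z‖` about `z` the speed is at most `(1 + L) * ‖h z‖`, so
Picard–Lindelöf gives a lifetime `1 / (1 + L)` that does not depend on `z`. -/
theorem exists_hasDerivWithinAt_Icc_of_lipschitzWith (hL : LipschitzWith L h) :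
    ∃ τ : ℝ, 0 < τ ∧ ∀ z : E, ∃ x : ℝ → E, x 0 = z ∧
      ∀ t ∈ Icc 0 τ, HasDerivWithinAt x (h (x t)) (Icc 0 τ) t := by
  refine ⟨1 / (1 + L), by positivity, fun z => ?_⟩
  have hτ : (0 : ℝ) ≤ 1 / (1 + L) := by positivity
  have hP : IsPicardLindelof (fun _ : ℝ => h) (tmin := 0) (tmax := 1 / (1 + L))
      ⟨0, left_mem_Icc.2 hτ⟩ z ‖h z‖₊ 0 ((1 + L) * ‖h z‖₊) L := by
    refine ⟨fun _ _ => hL.lipschitzOnWith, fun _ _ => continuousOn_const, ?_, ?_⟩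
    · intro _ _ y hy
      have h1 : ‖h y - h z‖ ≤ L * ‖y - z‖ := hL.norm_sub_le y z
      have h2 : ‖y - z‖ ≤ ‖h z‖ := by simpa [dist_eq_norm] using hy
      have h3 : ‖h y‖ ≤ ‖h y - h z‖ + ‖h z‖ := by simpa using norm_add_le (h y - h z) (h z)
      have h4 : (L : ℝ) * ‖y - z‖ ≤ L * ‖h z‖ := by gcongr
      push_cast
      linarith
    · rw [sub_zero, sub_self, max_eq_left hτ]
      push_cast
      rw [sub_zero, mul_one_div, mul_div_cancel_left₀ _ (by positivity)]
  exact hP.exists_eq_forall_mem_Icc_hasDerivWithinAt₀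

/-- The uniform lifetime allows gluing to length `n * τ` for every `n`; uniqueness makes these
solutions agree on overlaps. -/
theorem exists_isForwardSolution (hL : LipschitzWith L h) (z : E) :
    ∃ x : ℝ → E, x 0 = z ∧ IsForwardSolution h x := by
  obtain ⟨τ, hτ, hloc⟩ := exists_hasDerivWithinAt_Icc_of_lipschitzWith hL
  have key : ∀ n : ℕ, ∃ x : ℝ → E, x 0 = z ∧
      ∀ t ∈ Icc 0 (n * τ), HasDerivWithinAt x (h (x t)) (Icc 0 (n * τ)) t := by
    intro n
    induction n with
    | zero =>
      obtain ⟨x, hx0, hx⟩ := hloc z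
      refine ⟨x, hx0, fun t ht => ?_⟩
      have hs : Icc (0 : ℝ) ((0 : ℕ) * τ) ⊆ Icc 0 τ := Icc_subset_Icc_right (by simpa using hτ.le)
      exact (hx t (hs ht)).mono hs
    | succ n ih =>
      obtain ⟨x, hx0, hx⟩ := ih
      obtain ⟨y, hy0, hy⟩ := hloc (x (n * τ))
      obtain ⟨w, hw0, hw⟩ := HasDerivWithinAt.glue_Icc (by positivity) hτ.le hx hy hy0
      refine ⟨w, hw0.trans hx0, ?_⟩
      have : ((n + 1 : ℕ) : ℝ) * τ = n * τ + τ := by push_cast; ring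
      rwa [this]
  choose X hX0 hX using key
  have hXc : ∀ n : ℕ, ContinuousOn (X n) (Icc 0 (n * τ)) :=
    fun n t ht => (hX n t ht).continuousWithinAt
  have hXr : ∀ n : ℕ, ∀ t ∈ Ico 0 (n * τ), HasDerivWithinAt (X n) (h (X n t)) (Ici t) t := by
    intro n t ht
    refine ((hX n t (Ico_subset_Icc_self ht)).mono (Icc_subset_Icc_left ht.1)).mono_of_mem_nhdsWithin
      (Icc_mem_nhdsGE ht.2)
  have agree : ∀ m n : ℕ, m ≤ n → EqOn (X m) (X n) (Icc 0 (m * τ)) := by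
    intro m n hmn
    have hle : (m : ℝ) * τ ≤ n * τ := by gcongr
    exact ODE_solution_unique (v := fun _ => h) (K := L) (fun _ => hL) (hXc m) (hXr m)
      ((hXc n).mono (Icc_subset_Icc_right hle))
      (fun t ht => hXr n t ⟨ht.1, ht.2.trans_le hle⟩) (by rw [hX0, hX0])
  have hN : ∀ t : ℝ, ∃ n : ℕ, t < n * τ := fun t => by
    obtain ⟨n, hn⟩ := exists_nat_gt (t / τ)
    exact ⟨n, (div_lt_iff₀ hτ).1 hn⟩
  choose N hN using hN
  have xeq : ∀ n : ℕ, EqOn (fun t => X (N t) t) (X n) (Icc 0 (n * τ)) := by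
    intro n t ht
    rcases le_total n (N t) with hle | hle
    · exact (agree _ _ hle ht).symm
    · exact agree _ _ hle ⟨ht.1, (hN t).le⟩
  refine ⟨fun t => X (N t) t, hX0 _, fun t ht => ?_⟩
  have h1 := (hX (N t) t ⟨ht, (hN t).le⟩).congr (xeq (N t)) (xeq (N t) ⟨ht, (hN t).le⟩)
  refine h1.mono_of_mem_nhdsWithin ?_
  rw [← Ici_inter_Iic]
  exact inter_mem_nhdsWithin _ (Iic_mem_nhds (hN t))

end Flow

/-! ### Lyapunov stability and uniform attraction. -/

section Stability

variable {d : ℕ} {V : EuclideanSpace ℝ (Fin d) → ℝ}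
  {h : EuclideanSpace ℝ (Fin d) → EuclideanSpace ℝ (Fin d)} {L : ℝ≥0}
  {G H B U : Set (EuclideanSpace ℝ (Fin d))}

/-- A Lyapunov function does not increase along a trajectory that stays in its domain. -/
theorem IsStrictLyapunov.antitoneOn (hV : IsStrictLyapunov V h G H)
    {x : ℝ → EuclideanSpace ℝ (Fin d)} (hx : IsForwardSolution h x) {T : ℝ}
    (hG : ∀ t ∈ Icc 0 T, x t ∈ G) : AntitoneOn (fun t => V (x t)) (Icc 0 T) := by
  have hd : ∀ t ∈ Icc 0 T, HasDerivWithinAt (fun t => V (x t))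
      (inner ℝ (gradient V (x t)) (h (x t))) (Icc 0 T) t := by
    intro t ht
    have h1 := (hV.differentiableAt _ (hG t ht)).hasGradientAt.hasFDerivAt
    simpa [Function.comp_def] using h1.comp_hasDerivWithinAt t ((hx t ht.1).mono Icc_subset_Ici_self)
  refine antitoneOn_of_hasDerivWithinAt_nonpos (convex_Icc 0 T)
    (fun t ht => (hd t ht).continuousWithinAt)
    (fun t ht => (hd t (interior_subset ht)).mono interior_subset)
    (fun t ht => hV.inner_nonpos _ (hG t (interior_subset ht)))

/-- The zero set of a Lyapunov function is Lyapunov stable. -/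
theorem IsStrictLyapunov.exists_stable_nhds (hV : IsStrictLyapunov V h G H)
    (hU : IsOpen U) (hHU : H ⊆ U) :
    ∃ W, IsOpen W ∧ H ⊆ W ∧ ∀ x : ℝ → EuclideanSpace ℝ (Fin d), IsForwardSolution h x →
      x 0 ∈ W → ∀ t, 0 ≤ t → x t ∈ U := by
  have hHG : H ⊆ G := by rw [hV.eq_zero_set]; exact fun z hz => hz.1
  obtain ⟨δ, hδ, hδU⟩ := hV.isCompact.exists_cthickening_subset_open (hU.inter hV.isOpen)
    (subset_inter hHU hHG)
  have hcpt : IsCompact (Metric.cthickening δ H) := hV.isCompact.cthickening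
  -- On this compact shell `V` has a positive lower bound `c`. A trajectory starting inside with `V
  -- < c` cannot reach the shell, because `V` does not increase.
  set S := Metric.cthickening δ H \ Metric.thickening δ H with hS
  have hScpt : IsCompact S := hcpt.diff Metric.isOpen_thickening
  have hVc : ContinuousOn V G := fun z hz => (hV.differentiableAt z hz).continuousAt.continuousWithinAt
  have hSG : S ⊆ G := fun z hz => (hδU hz.1).2
  have hVpos : ∀ z ∈ S, 0 < V z := by
    intro z hz
    refine lt_of_le_of_ne (hV.nonneg z (hSG hz)) fun h0 => hz.2 ?_
    refine Metric.self_subset_thickening hδ H ?_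
    rw [hV.eq_zero_set]
    exact ⟨hSG hz, h0.symm⟩
  obtain ⟨c, hc, hcS⟩ : ∃ c : ℝ, 0 < c ∧ ∀ z ∈ S, c ≤ V z := by
    rcases S.eq_empty_or_nonempty with hne | hne
    · exact ⟨1, one_pos, by simp [hne]⟩
    · obtain ⟨z, hz, hmin⟩ := hScpt.exists_isMinOn hne (hVc.mono hSG)
      exact ⟨V z, hVpos z hz, fun y hy => hmin hy⟩
  have hTG : Metric.thickening δ H ⊆ G := fun z hz =>
    (hδU (Metric.thickening_subset_cthickening _ _ hz)).2
  refine ⟨Metric.thickening δ H ∩ V ⁻¹' Iio c,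
    (hVc.mono hTG).isOpen_inter_preimage Metric.isOpen_thickening isOpen_Iio, ?_, ?_⟩
  · intro z hz
    have hz' := hz
    rw [hV.eq_zero_set] at hz'
    exact ⟨Metric.self_subset_thickening hδ H hz, by simpa [hz'.2] using hc⟩
  intro x hx hx0 t ht
  suffices x t ∈ Metric.thickening δ H from
    (hδU (Metric.thickening_subset_cthickening _ _ this)).1
  by_contra hnot
  -- The infimum of `A` is the first exit time; by continuity the exit point lies on the shell.
  set A := Icc 0 t ∩ x ⁻¹' (Metric.thickening δ H)ᶜ with hA
  have hAcl : IsClosed A := (hx.continuousOn.mono Icc_subset_Ici_self).preimage_isClosed_of_isClosed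
    isClosed_Icc Metric.isOpen_thickening.isClosed_compl
  have hAne : A.Nonempty := ⟨t, ⟨ht, le_rfl⟩, hnot⟩
  have hAbdd : BddBelow A := ⟨0, fun s hs => hs.1.1⟩
  have hs0 := hAcl.csInf_mem hAne hAbdd
  set s := sInf A
  have hlt : ∀ r ∈ Ico 0 s, x r ∈ Metric.thickening δ H := by
    intro r hr
    by_contra hr'
    exact hr.2.not_ge (csInf_le hAbdd ⟨⟨hr.1, hr.2.le.trans hs0.1.2⟩, hr'⟩)
  have hspos : 0 < s := by
    refine lt_of_le_of_ne hs0.1.1 fun h0 => hs0.2 ?_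
    rw [← h0]
    exact hx0.1
  have hsS : x s ∈ S := by
    refine ⟨?_, hs0.2⟩
    have hcl : s ∈ closure (Ico 0 s) := by
      rw [closure_Ico hspos.ne]
      exact ⟨hspos.le, le_rfl⟩
    have := ((hx s hspos.le).continuousWithinAt.mono Ico_subset_Ici_self).mem_closure hcl
      (t := Metric.thickening δ H) hlt
    exact Metric.closure_thickening_subset_cthickening _ _ this
  have hanti := hV.antitoneOn hx (T := s) (fun r hr => by
    rcases hr.2.lt_or_eq with h' | h'
    · exact hTG (hlt r ⟨hr.1, h'⟩)
    · rw [h']; exact hSG hsS)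
  have h1 := hanti (left_mem_Icc.2 hspos.le) (right_mem_Icc.2 hspos.le) hspos.le
  have h2 : V (x 0) < c := hx0.2
  have h3 := hcS _ hsS
  simp only at h1
  linarith

/-- Attraction of a stable set is uniform on compact subsets of the domain of attraction. -/
theorem IsStrictLyapunov.exists_uniform_time (hV : IsStrictLyapunov V h G H)
    (hL : LipschitzWith L h) {K : Set (EuclideanSpace ℝ (Fin d))} (hK : IsCompact K)
    (hKattr : K ⊆ domainOfAttraction h H) (hU : IsOpen U) (hHU : H ⊆ U) :
    ∃ T, 0 ≤ T ∧ ∀ x : ℝ → EuclideanSpace ℝ (Fin d), IsForwardSolution h x →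
      x 0 ∈ K → ∀ t, T ≤ t → x t ∈ U := by
  obtain ⟨W, hWo, hHW, hW⟩ := hV.exists_stable_nhds hU hHU
  obtain ⟨δ, hδ, hδW⟩ := hV.isCompact.exists_thickening_subset_open hWo hHW
  have key : ∀ z ∈ K, ∃ t, 0 ≤ t ∧ ∃ N ∈ 𝓝 z, ∀ x : ℝ → EuclideanSpace ℝ (Fin d),
      IsForwardSolution h x → x 0 ∈ N → x t ∈ W := by
    intro z hz
    obtain ⟨y, hy0, hy⟩ := exists_isForwardSolution hL z
    have hlim := hKattr hz y hy0 hy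
    have hev : ∀ᶠ t in atTop, Metric.infEDist (y t) H < ENNReal.ofReal δ :=
      hlim.eventually_lt_const (by simpa using hδ)
    obtain ⟨t, hty, ht⟩ := (hev.and (eventually_ge_atTop 0)).exists
    have hyW : y t ∈ W := hδW hty
    obtain ⟨ρ, hρ, hρW⟩ := Metric.isOpen_iff.1 hWo _ hyW
    refine ⟨t, ht, Metric.ball z (ρ / Real.exp (L * t)), Metric.ball_mem_nhds _ (by positivity),
      fun x hx hx0 => hρW ?_⟩
    rw [Metric.mem_ball] at hx0 ⊢
    calc dist (x t) (y t) ≤ dist (x 0) (y 0) * Real.exp (L * t) := hx.dist_le hL hy ht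
      _ < ρ / Real.exp (L * t) * Real.exp (L * t) := by rw [hy0]; gcongr
      _ = ρ := by field_simp
  choose! τ hτ N hN hNW using key
  obtain ⟨F, hFK, hF⟩ := hK.elim_nhds_subcover N hN
  -- The sum is just a convenient upper bound for the finitely many entry times; once in `W`, a
  -- trajectory stays in `U`.
  refine ⟨∑ z ∈ F, τ z, Finset.sum_nonneg fun z hz => hτ z (hFK z hz), fun x hx hx0 t ht => ?_⟩
  obtain ⟨z, hzF, hz⟩ := mem_iUnion₂.1 (hF hx0)
  have hle : τ z ≤ t := (Finset.single_le_sum (fun z hz => hτ z (hFK z hz)) hzF).trans ht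
  have hz0 := hτ z (hFK z hzF)
  have := hW _ (hx.shift hz0) (by simpa using hNW z (hFK z hzF) x hx hz) (t - τ z) (by linarith)
  simpa using this

end Stability

theorem exists_forall_norm_sum_Ico_le {E : Type*} [SeminormedAddCommGroup E] {u : ℕ → E} {s : E}
    (hu : Tendsto (fun N => ∑ n ∈ Finset.range N, u n) atTop (𝓝 s)) {ε : ℝ} (hε : 0 < ε) :
    ∃ N : ℕ, ∀ n ≥ N, ∀ m ≥ n, ‖∑ k ∈ Finset.Ico n m, u k‖ ≤ ε := by
  obtain ⟨N, hN⟩ := Metric.cauchySeq_iff.1 hu.cauchySeq ε hε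
  refine ⟨N, fun n hn m hm => ?_⟩
  rw [Finset.sum_Ico_eq_sub _ hm, ← dist_eq_norm]
  exact (hN m (hn.trans hm) n hn).le

/-! ### Iterates follow the ODE over bounded time. -/

section Tracking

variable {E : Type*} [NormedAddCommGroup E] [NormedSpace ℝ E] {h : E → E} {L : ℝ≥0}

/-- Error of one explicit Euler step. -/
theorem IsForwardSolution.norm_euler_le (hL : LipschitzWith L h) {x : ℝ → E}
    (hx : IsForwardSolution h x) {C T s α : ℝ} (hC : ∀ t ∈ Icc 0 T, ‖h (x t)‖ ≤ C)
    (hs : 0 ≤ s) (hα : 0 ≤ α) (hsT : s + α ≤ T) :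
    ‖x (s + α) - x s - α • h (x s)‖ ≤ L * C * α ^ 2 := by
  have hC0 : 0 ≤ C := (norm_nonneg _).trans (hC 0 ⟨le_rfl, by linarith⟩)
  have hy := hx.shift hs
  have hyd : ∀ u ∈ Icc 0 α, HasDerivWithinAt (fun t => x (s + t)) (h (x (s + u))) (Icc 0 α) u :=
    fun u hu => (hy u hu.1).mono Icc_subset_Ici_self
  have h1 : ∀ u ∈ Icc 0 α, ‖x (s + u) - x s‖ ≤ C * u := by
    intro u hu
    have := (convex_Icc 0 α).norm_image_sub_le_of_norm_hasDerivWithin_le (C := C) hyd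
      (fun v hv => hC _ ⟨by linarith [hv.1], by linarith [hv.2]⟩) (left_mem_Icc.2 hα) hu
    simpa [abs_of_nonneg hu.1] using this
  -- Once the linear motion is removed, the derivative is at most `L * (C * α)`, and the mean value
  -- inequality gives the second-order error.
  have h2 : ∀ u ∈ Icc 0 α, HasDerivWithinAt (fun t => x (s + t) - t • h (x s))
      (h (x (s + u)) - h (x s)) (Icc 0 α) u := by
    intro u hu
    simpa [Pi.sub_def] using (hyd u hu).sub ((hasDerivWithinAt_id u _).smul_const (h (x s)))
  have h3 := (convex_Icc 0 α).norm_image_sub_le_of_norm_hasDerivWithin_le (C := L * (C * α)) h2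
    (fun v hv => by
      refine (hL.norm_sub_le _ _).trans ?_
      have := h1 v hv
      have h4 : C * v ≤ C * α := mul_le_mul_of_nonneg_left hv.2 hC0
      gcongr
      linarith) (left_mem_Icc.2 hα) (right_mem_Icc.2 hα)
  simp only [add_zero, zero_smul, sub_zero, Real.norm_of_nonneg hα] at h3
  calc _ = ‖x (s + α) - α • h (x s) - x s‖ := by congr 1; abel
    _ ≤ _ := h3
    _ = _ := by ring

/-- If the accumulated noise of a stochastic approximation scheme is negligible as long as the
iterates stay bounded, then the iterates track the solutions of the limiting equation over
bounded time intervals. -/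
theorem exists_forall_norm_sub_forwardSolution_le (hL : LipschitzWith L h) {θ ξ : ℕ → E} {a : ℕ → ℝ}
    (ha : ∀ n, 0 ≤ a n) (hasq : Summable fun n => a n ^ 2)
    (hrec : ∀ n, θ (n + 1) = θ n + a n • (h (θ n) + ξ n))
    (hnoise : ∀ R ε : ℝ, 0 < ε → ∃ N : ℕ, ∀ n ≥ N, ∀ m ≥ n,
      (∀ k ∈ Finset.Ico n m, ‖θ k‖ ≤ R) → ‖∑ k ∈ Finset.Ico n m, a k • ξ k‖ ≤ ε)
    (ρ : ℝ) {T η : ℝ} (hT : 0 ≤ T) (hη : 0 < η) :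
    ∃ N : ℕ, ∀ n ≥ N, ‖θ n‖ ≤ ρ → ∀ x : ℝ → E, IsForwardSolution h x → x 0 = θ n →
      ∀ m ≥ n, ∑ k ∈ Finset.Ico n m, a k ≤ T → ‖θ m - x (∑ k ∈ Finset.Ico n m, a k)‖ ≤ η := by
  -- `c₀` bounds the initial speed, `R - η` the solution up to time `T`, and `C` its speed there.
  -- Iterates within `η` of the solution thus stay in the ball of radius `R`; `D` is the factor by
  -- which Grönwall amplifies the tolerance `ε`.
  set c₀ : ℝ := ‖h 0‖ + L * |ρ| with hc₀
  have hc₀0 : 0 ≤ c₀ := by positivity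
  set R : ℝ := |ρ| + gronwallBound 0 L c₀ T + η with hR
  set C : ℝ := ‖h 0‖ + L * R with hC
  have hg0 : 0 ≤ gronwallBound 0 L c₀ T := by
    have := gronwallBound_mono le_rfl hc₀0 L.2 hT
    simpa [gronwallBound_x0] using this
  have hC0 : 0 ≤ C := by positivity
  have hgrow : ∀ z : E, ‖h z‖ ≤ ‖h 0‖ + L * ‖z‖ := by
    intro z
    have h1 := hL.norm_sub_le z 0
    have h2 : ‖h z‖ ≤ ‖h z - h 0‖ + ‖h 0‖ := by simpa using norm_add_le (h z - h 0) (h 0)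
    rw [sub_zero] at h1
    linarith
  set D : ℝ := 1 + (L * T + L * C) * Real.exp (L * T) with hD
  have hD0 : 0 < D := by positivity
  set ε : ℝ := η / D with hε
  have hε0 : 0 < ε := by positivity
  obtain ⟨N₁, hN₁⟩ := hnoise R ε hε0
  obtain ⟨N₂, hN₂⟩ : ∃ N₂ : ℕ, ∀ n ≥ N₂, ∀ m ≥ n, ∑ k ∈ Finset.Ico n m, a k ^ 2 ≤ ε := by
    obtain ⟨N₂, hN₂⟩ := exists_forall_norm_sum_Ico_le hasq.hasSum.tendsto_sum_nat hε0
    exact ⟨N₂, fun n hn m hm => (le_abs_self _).trans (hN₂ n hn m hm)⟩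
  refine ⟨max N₁ N₂, fun n hn hθn x hx hx0 => ?_⟩
  have hn1 : N₁ ≤ n := (le_max_left _ _).trans hn
  have hn2 : N₂ ≤ n := (le_max_right _ _).trans hn
  have hρ : ‖θ n‖ ≤ |ρ| := hθn.trans (le_abs_self ρ)
  have hxbd : ∀ t ∈ Icc 0 T, ‖x t‖ ≤ R - η := by
    intro t ht
    have h1 : ‖h (x 0)‖ ≤ c₀ := by
      rw [hx0]
      refine (hgrow _).trans ?_
      rw [hc₀]
      gcongr
    have h2 := hx.norm_sub_le hL h1 ht.1
    have h3 := gronwallBound_mono le_rfl hc₀0 L.2 ht.2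
    have h4 : ‖x t‖ ≤ ‖x t - x 0‖ + ‖x 0‖ := by simpa using norm_add_le (x t - x 0) (x 0)
    rw [hx0] at h4 h2
    have h5 : gronwallBound 0 (L : ℝ) c₀ t ≤ gronwallBound 0 L c₀ T := h3
    linarith
  have hhx : ∀ t ∈ Icc 0 T, ‖h (x t)‖ ≤ C := by
    intro t ht
    refine (hgrow _).trans ?_
    have := hxbd t ht
    rw [hC]
    gcongr
    linarith
  set s : ℕ → ℝ := fun m => ∑ k ∈ Finset.Ico n m, a k with hs
  set q : ℕ → ℝ := fun m => ∑ k ∈ Finset.Ico n m, a k ^ 2 with hq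
  set w : ℕ → E := fun m => ∑ k ∈ Finset.Ico n m, a k • ξ k with hw
  have hs0 : ∀ m, 0 ≤ s m := fun m => Finset.sum_nonneg fun k _ => ha k
  have hq0 : ∀ m, 0 ≤ q m := fun m => Finset.sum_nonneg fun k _ => sq_nonneg _
  have hclose : ∀ m ≥ n, s m ≤ T → ‖w m‖ ≤ ε →
      ‖θ m - x (s m) - w m‖ ≤ (L * ε * s m + L * C * q m) * Real.exp (L * s m) →
      ‖θ m - x (s m)‖ ≤ η := by
    intro m hnm hsm hwm hm
    have h1 : ‖θ m - x (s m)‖ ≤ ‖θ m - x (s m) - w m‖ + ‖w m‖ := by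
      simpa using norm_add_le (θ m - x (s m) - w m) (w m)
    have h2 : (L * ε * s m + L * C * q m) * Real.exp (L * s m) ≤
        (L * ε * T + L * C * ε) * Real.exp (L * T) := by
      have := hN₂ n hn2 m hnm
      have := hs0 m
      have := hq0 m
      gcongr
    have h3 : (L * ε * T + L * C * ε) * Real.exp (L * T) + ε = η := by
      have : (L * ε * T + L * C * ε) * Real.exp (L * T) + ε = ε * D := by rw [hD]; ring
      rw [this, hε]
      field_simp
    linarith
  have hbound : ∀ m, s m ≤ T → ‖θ m - x (s m)‖ ≤ η → ‖θ m‖ ≤ R := by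
    intro m hsm hm
    have h1 := hxbd (s m) ⟨hs0 m, hsm⟩
    have h2 : ‖θ m‖ ≤ ‖θ m - x (s m)‖ + ‖x (s m)‖ := by
      simpa using norm_add_le (θ m - x (s m)) (x (s m))
    linarith
  -- Both claims need a joint induction: the noise bound requires bounded earlier iterates, and
  -- closeness to the solution bounds the next one. Subtracting the whole noise sum `w m` preserves
  -- its cancellations.
  have main : ∀ m ≥ n, s m ≤ T → (∀ k ∈ Finset.Ico n m, ‖θ k‖ ≤ R) ∧
      ‖θ m - x (s m) - w m‖ ≤ (L * ε * s m + L * C * q m) * Real.exp (L * s m) := by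
    intro m hm
    induction m, hm using Nat.le_induction with
    | base =>
      intro _
      simp [hs, hq, hw, hx0]
    | succ m hm ih =>
      intro hsT
      have hs1 : s (m + 1) = s m + a m := Finset.sum_Ico_succ_top hm _
      have hq1 : q (m + 1) = q m + a m ^ 2 := Finset.sum_Ico_succ_top hm _
      have hw1 : w (m + 1) = w m + a m • ξ m := Finset.sum_Ico_succ_top hm _
      have hsm : s m ≤ T := by linarith [ha m]
      obtain ⟨ih1, ih2⟩ := ih hsm
      have hwm : ‖w m‖ ≤ ε := hN₁ n hn1 m hm ih1
      have hm' := hclose m hm hsm hwm ih2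
      refine ⟨fun k hk => ?_, ?_⟩
      · rcases Finset.mem_Ico.1 hk with ⟨hk1, hk2⟩
        rcases (Nat.lt_succ_iff.1 hk2).lt_or_eq with h' | h'
        · exact ih1 k (Finset.mem_Ico.2 ⟨hk1, h'⟩)
        · rw [h']; exact hbound m hsm hm'
      have hstep := hx.norm_euler_le hL hhx (hs0 m) (ha m) (by linarith)
      rw [hs1, hq1, hw1, hrec m]
      set e := θ m - x (s m) - w m with he
      have hdec : θ m + a m • (h (θ m) + ξ m) - x (s m + a m) - (w m + a m • ξ m) =
          e + a m • (h (θ m) - h (x (s m))) - (x (s m + a m) - x (s m) - a m • h (x (s m))) := by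
        rw [he]; module
      have hLe : ‖h (θ m) - h (x (s m))‖ ≤ L * (‖e‖ + ε) := by
        refine (hL.norm_sub_le _ _).trans ?_
        have : ‖θ m - x (s m)‖ ≤ ‖e‖ + ‖w m‖ := by
          simpa [he] using norm_add_le (θ m - x (s m) - w m) (w m)
        gcongr
        linarith
      have h5 : ‖a m • (h (θ m) - h (x (s m)))‖ ≤ a m * (L * (‖e‖ + ε)) := by
        rw [norm_smul, Real.norm_of_nonneg (ha m)]
        exact mul_le_mul_of_nonneg_left hLe (ha m)
      have h6 : ‖e + a m • (h (θ m) - h (x (s m))) -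
          (x (s m + a m) - x (s m) - a m • h (x (s m)))‖ ≤
          ‖e‖ + a m * (L * (‖e‖ + ε)) + L * C * a m ^ 2 :=
        (norm_sub_le _ _).trans (add_le_add ((norm_add_le _ _).trans (by linarith)) hstep)
      rw [hdec]
      refine h6.trans ?_
      have ha' := ha m
      -- Discrete Grönwall: the one-step growth factor is absorbed into the exponential of elapsed
      -- time.
      have hexp : 1 + L * a m ≤ Real.exp (L * a m) := by linarith [Real.add_one_le_exp (L * a m)]
      have hexp1 : 1 ≤ Real.exp (L * (s m + a m)) :=
        Real.one_le_exp (mul_nonneg L.2 (add_nonneg (hs0 m) ha'))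
      have hsplit : Real.exp (L * (s m + a m)) = Real.exp (L * s m) * Real.exp (L * a m) := by
        rw [← Real.exp_add]; ring_nf
      calc ‖e‖ + a m * (L * (‖e‖ + ε)) + L * C * a m ^ 2
          = (1 + L * a m) * ‖e‖ + (L * ε * a m + L * C * a m ^ 2) * 1 := by ring
        _ ≤ Real.exp (L * a m) * ((L * ε * s m + L * C * q m) * Real.exp (L * s m)) +
            (L * ε * a m + L * C * a m ^ 2) * Real.exp (L * (s m + a m)) := by
          gcongr
        _ = _ := by rw [hsplit]; ring
  intro m hm hsm
  obtain ⟨h1, h2⟩ := main m hm hsm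
  exact hclose m hm hsm (hN₁ n hn1 m hm h1) h2

end Tracking

/-- A stochastic approximation scheme with asymptotically negligible noise that visits infinitely
often a relatively compact neighbourhood in the domain of attraction converges to the attractor. -/
theorem IsStrictLyapunov.eventually_mem_of_frequently_mem {d : ℕ}
    {V : EuclideanSpace ℝ (Fin d) → ℝ}
    {h : EuclideanSpace ℝ (Fin d) → EuclideanSpace ℝ (Fin d)} {L : ℝ≥0}
    {G H B U : Set (EuclideanSpace ℝ (Fin d))}
    (hV : IsStrictLyapunov V h G H) (hL : LipschitzWith L h)
    (hBo : IsOpen B) (hBc : IsCompact (closure B)) (hHB : H ⊆ B)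
    (hBattr : closure B ⊆ domainOfAttraction h H)
    {θ ξ : ℕ → EuclideanSpace ℝ (Fin d)} {a : ℕ → ℝ}
    (ha : ∀ n, 0 ≤ a n) (hasq : Summable fun n => a n ^ 2)
    (hasum : Tendsto (fun N => ∑ n ∈ Finset.range N, a n) atTop atTop)
    (hrec : ∀ n, θ (n + 1) = θ n + a n • (h (θ n) + ξ n))
    (hnoise : ∀ R ε : ℝ, 0 < ε → ∃ N : ℕ, ∀ n ≥ N, ∀ m ≥ n,
      (∀ k ∈ Finset.Ico n m, ‖θ k‖ ≤ R) → ‖∑ k ∈ Finset.Ico n m, a k • ξ k‖ ≤ ε)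
    (hfreq : ∃ᶠ n in atTop, θ n ∈ B) (hU : IsOpen U) (hHU : H ⊆ U) :
    ∀ᶠ n in atTop, θ n ∈ U := by
  obtain ⟨δ, hδ, hδU⟩ := hV.isCompact.exists_thickening_subset_open (hU.inter hBo)
    (subset_inter hHU hHB)
  obtain ⟨T₀, hT₀, hT₀U⟩ := hV.exists_uniform_time hL hBc hBattr
    (Metric.isOpen_thickening (δ := δ / 2) (E := H)) (Metric.self_subset_thickening (by linarith) H)
  obtain ⟨ρ, hρ⟩ := hBc.isBounded.exists_norm_le
  -- Thus `T ≥ 1`, which dominates the late step sizes and leaves slack in the window from `T` to `3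
  -- * T`.
  set T := T₀ + 1 with hT
  obtain ⟨N₁, hN₁⟩ := exists_forall_norm_sub_forwardSolution_le hL ha hasq hrec hnoise ρ
    (T := 3 * T) (η := δ / 4) (by linarith) (by linarith)
  have ha0 : ∀ᶠ n in atTop, a n ≤ 1 := by
    filter_upwards [hasq.tendsto_atTop_zero.eventually_lt_const one_pos] with n hn
    nlinarith [ha n]
  obtain ⟨N₂, hN₂⟩ := eventually_atTop.1 ha0
  set A : ℕ → ℝ := fun m => ∑ k ∈ Finset.range m, a k with hA
  have hsA : ∀ n m, n ≤ m → ∑ k ∈ Finset.Ico n m, a k = A m - A n := fun n m hnm =>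
    Finset.sum_Ico_eq_sub _ hnm
  have htrack : ∀ n ≥ N₁, θ n ∈ B → ∀ m ≥ n, T ≤ A m - A n → A m - A n ≤ 3 * T →
      θ m ∈ U ∩ B := by
    intro n hn hnB m hm h1 h2
    obtain ⟨x, hx0, hx⟩ := exists_isForwardSolution hL (θ n)
    have h3 := hN₁ n hn (hρ _ (subset_closure hnB)) x hx hx0 m hm
    rw [hsA n m hm] at h3
    have h4 := h3 h2
    have h5 := hT₀U x hx (by rw [hx0]; exact subset_closure hnB) (A m - A n) (by linarith)
    obtain ⟨z, hz, hzd⟩ := Metric.mem_thickening_iff.1 h5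
    refine hδU (Metric.mem_thickening_iff.2 ⟨z, hz, ?_⟩)
    rw [← dist_eq_norm] at h4
    linarith [dist_triangle (θ m) (x (A m - A n)) z]
  obtain ⟨n₀, hn₀, hn₀B⟩ := frequently_atTop.1 hfreq (max N₁ N₂)
  have hn₀1 : N₁ ≤ n₀ := (le_max_left _ _).trans hn₀
  have hn₀2 : N₂ ≤ n₀ := (le_max_right _ _).trans hn₀
  have key : ∀ m, n₀ ≤ m → T ≤ A m - A n₀ → θ m ∈ U ∩ B := by
    intro m
    induction m using Nat.strong_induction_on with
    | _ m ih =>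
      intro hm hTm
      rcases le_or_gt (A m - A n₀) (3 * T) with hle | hgt
      · exact htrack n₀ hn₀1 hn₀B m hm hTm hle
      -- Restart from the last index at least `T` before `m`. As `a k ≤ 1 ≤ T`, the elapsed time
      -- from `k` to `m` is at most `2 * T`, while `k` is still at least `T` after `n₀`, so
      -- induction puts `θ k` in `B`.
      set k := Nat.findGreatest (fun k => A k ≤ A m - T) m with hk
      have hkP : A k ≤ A m - T := Nat.findGreatest_spec (P := fun k => A k ≤ A m - T) hm
        (by linarith)
      have hkn : n₀ ≤ k := Nat.le_findGreatest hm (by linarith)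
      have hkm : k ≤ m := Nat.findGreatest_le m
      have hkm' : k < m := by
        refine lt_of_le_of_ne hkm fun h' => ?_
        rw [h'] at hkP
        linarith
      have hk1 : A m - T < A (k + 1) := by
        by_contra! hcon
        have : k + 1 ≤ k := Nat.le_findGreatest hkm' hcon
        omega
      have hAk : A (k + 1) = A k + a k := Finset.sum_range_succ _ _
      have hak : a k ≤ 1 := hN₂ k (hn₀2.trans hkn)
      exact htrack k (hn₀1.trans hkn) (ih k hkm' hkn (by linarith)).2 m hkm (by linarith)
        (by linarith)
  filter_upwards [hasum.eventually_ge_atTop (T + A n₀), eventually_ge_atTop n₀] with m h1 h2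
  exact (key m h2 (by simp only [hA] at h1 ⊢; linarith)).1

/-! ### Square integrable martingales and conditional laws. -/

section Martingale

variable {Ω : Type*} [mΩ : MeasurableSpace Ω] {P : Measure Ω} [IsProbabilityMeasure P]

/-- A sum of square integrable martingale differences with summable second moments converges. -/
theorem ae_exists_tendsto_sum_of_summable_integral_sq {ℱ : Filtration ℕ mΩ} {D : ℕ → Ω → ℝ}
    (hD : ∀ n, StronglyMeasurable[ℱ (n + 1)] (D n)) (hL2 : ∀ n, MemLp (D n) 2 P)
    (h0 : ∀ n, P[D n | ℱ n] =ᵐ[P] 0) (hs : Summable fun n => ∫ ω, D n ω ^ 2 ∂P) :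
    ∀ᵐ ω ∂P, ∃ c, Tendsto (fun N => ∑ n ∈ Finset.range N, D n ω) atTop (𝓝 c) := by
  set S : ℕ → Ω → ℝ := fun N ω => ∑ n ∈ Finset.range N, D n ω with hS
  have hSs : ∀ N, S (N + 1) = S N + D N := fun N => by
    ext ω; simp [hS, Finset.sum_range_succ]
  have hSm : ∀ N, StronglyMeasurable[ℱ N] (S N) := fun N =>
    Finset.stronglyMeasurable_fun_sum _ fun n hn =>
      (hD n).mono (ℱ.mono (Nat.succ_le_of_lt (Finset.mem_range.1 hn)))
  have hS2 : ∀ N, MemLp (S N) 2 P := fun N => memLp_finsetSum _ fun n _ => hL2 n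
  have hSi : ∀ N, Integrable (S N) P := fun N => (hS2 N).integrable one_le_two
  have hDi : ∀ N, Integrable (D N) P := fun N => (hL2 N).integrable one_le_two
  have hmart : Martingale S ℱ P := by
    refine martingale_of_condExp_sub_eq_zero_nat hSm hSi fun n => ?_
    rw [hSs, add_sub_cancel_left]
    exact h0 n
  -- Orthogonality of increments makes the second moments of `S` additive; `|x| ≤ 1 + x ^ 2` then
  -- gives the L¹ bound needed for martingale convergence.
  have horth : ∀ N, ∫ ω, S N ω * D N ω ∂P = 0 := by
    intro N
    have hint : Integrable (S N * D N) P := (hS2 N).integrable_mul (hL2 N)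
    have h1 := condExp_mul_of_stronglyMeasurable_left (hSm N) hint (hDi N)
    have h2 : P[S N * D N | ℱ N] =ᵐ[P] 0 := by
      filter_upwards [h1, h0 N] with ω h1 h2
      simp [h1, h2]
    have h3 : ∫ ω, (S N * D N) ω ∂P = 0 := by
      rw [← integral_condExp (ℱ.le N), integral_congr_ae h2]
      simp
    exact h3
  have hsq : ∀ N, ∫ ω, S N ω ^ 2 ∂P = ∑ n ∈ Finset.range N, ∫ ω, D n ω ^ 2 ∂P := by
    intro N
    induction N with
    | zero => simp [hS]
    | succ N ih =>
      rw [Finset.sum_range_succ, ← ih]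
      have e : ∀ ω, S (N + 1) ω ^ 2 = S N ω ^ 2 + 2 * (S N ω * D N ω) + D N ω ^ 2 := by
        intro ω; rw [hSs]; simp only [Pi.add_apply]; ring
      have i1 : Integrable (fun ω => S N ω ^ 2) P := (hS2 N).integrable_sq
      have i2 : Integrable (fun ω => 2 * (S N ω * D N ω)) P :=
        ((hS2 N).integrable_mul (hL2 N)).const_mul 2
      have i3 : Integrable (fun ω => S N ω ^ 2 + 2 * (S N ω * D N ω)) P := i1.add i2
      simp_rw [e]
      rw [integral_add i3 (hL2 N).integrable_sq, integral_add i1 i2,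
        integral_const_mul, horth]
      ring
  have hbdd : ∀ N, eLpNorm (S N) 1 P ≤ ((1 + ∑' n, ∫ ω, D n ω ^ 2 ∂P).toNNReal : ℝ≥0) := by
    intro N
    rw [eLpNorm_one_eq_lintegral_enorm, ← ofReal_integral_norm_eq_lintegral_enorm (hSi N)]
    refine ENNReal.ofReal_le_ofReal ?_
    have h1 : ∫ ω, ‖S N ω‖ ∂P ≤ ∫ ω, (1 + S N ω ^ 2) ∂P := by
      refine integral_mono (hSi N).norm ((integrable_const _).add (hS2 N).integrable_sq) fun ω => ?_
      simp only [Real.norm_eq_abs]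
      nlinarith [sq_abs (S N ω), sq_nonneg (|S N ω| - 1)]
    rw [integral_add (integrable_const _) (hS2 N).integrable_sq, hsq] at h1
    have h2 := hs.sum_le_tsum (Finset.range N) fun n _ => integral_nonneg fun ω => sq_nonneg (D n ω)
    simp only [integral_const, probReal_univ, one_smul] at h1
    linarith
  exact hmart.submartingale.exists_ae_tendsto_of_bdd hbdd

/-- Integrate the inequality between conditional variance and conditional second moment. -/
theorem integral_sq_sub_condExp_le {m : MeasurableSpace Ω} (hm : m ≤ mΩ) {X : Ω → ℝ}
    (hX : MemLp X 2 P) : ∫ ω, (X ω - P[X | m] ω) ^ 2 ∂P ≤ ∫ ω, X ω ^ 2 ∂P := by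
  have h1 : ∫ ω, (Var[X; P | m]) ω ∂P = ∫ ω, (X ω - P[X | m] ω) ^ 2 ∂P := by
    have := setIntegral_condVar (hm := hm) (s := univ)
      (hX.sub (hX.condExp one_le_two)).integrable_sq MeasurableSet.univ
    simpa using this
  have h2 : ∫ ω, (P[X ^ 2 | m]) ω ∂P = ∫ ω, X ω ^ 2 ∂P := integral_condExp hm
  rw [← h1, ← h2]
  exact integral_mono_ae integrable_condVar integrable_condExp (condVar_ae_le_condExp_sq hm hX)

/-- Weighted sums of centred square integrable vectors converge, if the weights are square
summable and the second moments are bounded. -/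
theorem ae_exists_tendsto_sum_smul_sub_condExp {d : ℕ} {ℱ : Filtration ℕ mΩ}
    {Z : ℕ → Ω → EuclideanSpace ℝ (Fin d)} {a : ℕ → ℝ}
    (hZ : ∀ n, StronglyMeasurable[ℱ (n + 1)] (Z n)) (hL2 : ∀ n, MemLp (Z n) 2 P) {c : ℝ}
    (hc : ∀ n, ∫ ω, ‖Z n ω‖ ^ 2 ∂P ≤ c) (hasq : Summable fun n => a n ^ 2) :
    ∀ᵐ ω ∂P, ∃ s, Tendsto (fun N => ∑ n ∈ Finset.range N, a n • (Z n ω - P[Z n | ℱ n] ω))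
      atTop (𝓝 s) := by
  have hcoord : ∀ i : Fin d, ∀ᵐ ω ∂P, ∃ s, Tendsto (fun N => ∑ n ∈ Finset.range N,
      a n * (Z n ω i - P[fun ω => Z n ω i | ℱ n] ω)) atTop (𝓝 s) := by
    intro i
    have hm : ∀ n, StronglyMeasurable[ℱ (n + 1)] (fun ω => Z n ω i) := fun n =>
      (EuclideanSpace.proj (𝕜 := ℝ) i).continuous.comp_stronglyMeasurable (hZ n)
    have hi2 : ∀ n, MemLp (fun ω => Z n ω i) 2 P := fun n =>
      (EuclideanSpace.proj (𝕜 := ℝ) i).comp_memLp' (hL2 n)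
    have hD2 : ∀ n, MemLp (fun ω => Z n ω i - P[fun ω => Z n ω i | ℱ n] ω) 2 P := fun n =>
      (hi2 n).sub ((hi2 n).condExp one_le_two)
    refine ae_exists_tendsto_sum_of_summable_integral_sq (ℱ := ℱ) (fun n => ?_)
      (fun n => (hD2 n).const_mul (a n)) (fun n => ?_) ?_
    · exact ((hm n).sub (stronglyMeasurable_condExp.mono (ℱ.mono n.le_succ))).const_mul (a n)
    · have hi : Integrable (fun ω => Z n ω i) P := (hi2 n).integrable one_le_two
      have h1 : P[fun ω => a n * (Z n ω i - P[fun ω => Z n ω i | ℱ n] ω) | ℱ n] =ᵐ[P]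
          a n • P[(fun ω => Z n ω i) - P[fun ω => Z n ω i | ℱ n] | ℱ n] :=
        condExp_smul (a n) _ _
      have h2 := condExp_sub (m := ℱ n) hi (integrable_condExp (m := ℱ n) (f := fun ω => Z n ω i))
      have h3 : P[P[fun ω => Z n ω i | ℱ n] | ℱ n] = P[fun ω => Z n ω i | ℱ n] :=
        condExp_of_stronglyMeasurable (ℱ.le n) stronglyMeasurable_condExp integrable_condExp
      filter_upwards [h1, h2] with ω h1 h2
      rw [h1, Pi.smul_apply, h2, h3]
      simp
    · refine Summable.of_nonneg_of_le (fun n => integral_nonneg fun ω => sq_nonneg _) (fun n => ?_)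
        (hasq.mul_right c)
      simp_rw [mul_pow]
      rw [integral_const_mul]
      refine mul_le_mul_of_nonneg_left ?_ (sq_nonneg _)
      refine (integral_sq_sub_condExp_le (ℱ.le n) (hi2 n)).trans (le_trans ?_ (hc n))
      refine integral_mono (hi2 n).integrable_sq (hL2 n).integrable_norm_pow' fun ω => ?_
      have := PiLp.norm_apply_le (Z n ω) i
      simp only
      rw [← sq_abs, ← Real.norm_eq_abs]
      gcongr
  have hcomm : ∀ᵐ ω ∂P, ∀ n, ∀ i, (P[Z n | ℱ n] ω) i = P[fun ω => Z n ω i | ℱ n] ω := by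
    rw [ae_all_iff]; intro n
    rw [ae_all_iff]; intro i
    exact (EuclideanSpace.proj (𝕜 := ℝ) i).comp_condExp_comm ((hL2 n).integrable one_le_two)
  filter_upwards [ae_all_iff.2 hcoord, hcomm] with ω h1 h2
  choose s hs using h1
  refine ⟨WithLp.toLp 2 s, ?_⟩
  have h3 := ((PiLp.continuous_toLp 2 (fun _ : Fin d => ℝ)).tendsto s).comp (tendsto_pi_nhds.2 hs)
  refine h3.congr fun N => ?_
  ext i
  simp [h2]

/-- Integration with respect to a version of the conditional law computes conditional
expectations. -/
theorem condExp_ae_eq_integral_of_condExp_indicator {E F : Type*} [MeasurableSpace E]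
    [StandardBorelSpace E] [Nonempty E] [NormedAddCommGroup F] [NormedSpace ℝ F] [CompleteSpace F]
    {Y : Ω → E} (hY : Measurable Y) {m : MeasurableSpace Ω} (hm : m ≤ mΩ)
    {κ : Ω → Measure E} [∀ ω, IsProbabilityMeasure (κ ω)]
    (hκ : ∀ A, MeasurableSet A → P⟦Y ⁻¹' A | m⟧ =ᵐ[P] fun ω => (κ ω).real A)
    {g : Ω × E → F} (hg : StronglyMeasurable[m.prod inferInstance] g)
    (hgi : Integrable[mΩ] (fun ω => g (ω, Y ω)) P) :
    P[fun ω => g (ω, Y ω) | m] =ᵐ[P] fun ω => ∫ y, g (ω, y) ∂(κ ω) := by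
  have hid : @Measurable Ω Ω mΩ m id := hm
  let η : @Kernel Ω E m _ := @condDistrib Ω Ω E _ _ _ mΩ m Y id P _
  have hηm : ∀ ω, IsProbabilityMeasure (η ω) := fun ω => by
    have : @IsMarkovKernel Ω E m _ η := by
      unfold η
      infer_instance
    exact this.isProbabilityMeasure ω
  have h1 : ∀ A, MeasurableSet A → ∀ᵐ ω ∂P, (η ω).real A = (κ ω).real A := by
    intro A hA
    have := @condDistrib_ae_eq_condExp Ω Ω E _ _ _ mΩ P _ id Y m A hid hY hA
    rw [MeasurableSpace.comap_id] at this
    filter_upwards [this, hκ A hA] with ω h1 h2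
    exact h1.trans h2
  -- The exceptional null set depends on `A`. A countable generating algebra permits a single null
  -- set, and as a π-system it determines the measures; no measurability of `κ` is needed.
  have h2 : ∀ᵐ ω ∂P, η ω = κ ω := by
    obtain ⟨𝒜, h𝒜c, h𝒜⟩ := MeasurableSpace.CountablyGenerated.isCountablyGenerated (α := E)
    have hcount := countable_generateSetAlgebra h𝒜c
    have hgen : ‹MeasurableSpace E› = MeasurableSpace.generateFrom (generateSetAlgebra 𝒜) := by
      rw [generateFrom_generateSetAlgebra_eq, ← h𝒜]
    have h3 : ∀ᵐ ω ∂P, ∀ A ∈ generateSetAlgebra 𝒜, (η ω).real A = (κ ω).real A := by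
      rw [ae_ball_iff hcount]
      intro A hA
      refine h1 A ?_
      rw [hgen]
      exact MeasurableSpace.measurableSet_generateFrom hA
    filter_upwards [h3] with ω hω
    refine ext_of_generate_finite _ hgen isSetAlgebra_generateSetAlgebra.isSetRing.isSetSemiring.isPiSystem
      (fun A hA => ?_) (by simp)
    exact (measureReal_eq_measureReal_iff).1 (hω A hA)
  have h3 := @condExp_prod_ae_eq_integral_condDistrib Ω Ω E F _ _ _ _ mΩ P _ id Y m g _ _ hid
    hY.aemeasurable hg hgi
  rw [MeasurableSpace.comap_id] at h3
  filter_upwards [h2, h3] with ω h2 h3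
  rw [← h2]
  exact h3

end Martingale

/-- Summation by parts for the part of the noise that comes from the Poisson equation. -/
theorem exists_forall_norm_sum_smul_poisson_le {E F G : Type*} [NormedAddCommGroup E]
    [NormedAddCommGroup F] [NormedAddCommGroup G] [NormedSpace ℝ G] {v : E → F → G}
    (hvreg : ∀ R : ℝ, 0 < R → ∃ C : ℝ, 0 < C ∧
      (∀ z x, ‖z‖ ≤ R → ‖v z x‖ ≤ C * (1 + ‖x‖)) ∧
      (∀ z z' x, ‖z‖ ≤ R → ‖z'‖ ≤ R → ‖v z x - v z' x‖ ≤ C * ‖z - z'‖ * (1 + ‖x‖)))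
    {θ : ℕ → E} {Y : ℕ → F} {a : ℕ → ℝ} {c Q : ℝ} (ha : ∀ n, 0 ≤ a n) (hanti : Antitone a)
    (hasq : Summable fun n => a n ^ 2) (hc : 0 ≤ c)
    (hθ : ∀ n, ‖θ (n + 1) - θ n‖ ≤ a n * (c * (1 + ‖θ n‖)))
    (hY : ∀ᶠ n in atTop, ‖Y n‖ ≤ Q) (R : ℝ) {ε : ℝ} (hε : 0 < ε) :
    ∃ N : ℕ, ∀ n ≥ N, ∀ m ≥ n, (∀ k ∈ Finset.Ico n m, ‖θ k‖ ≤ R) →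
      ‖∑ k ∈ Finset.Ico n m, a k • (v (θ k) (Y k) - v (θ k) (Y (k + 1)))‖ ≤ ε := by
  obtain ⟨N₁, hN₁⟩ := eventually_atTop.1 hY
  have hQ : 0 ≤ Q := (norm_nonneg _).trans (hN₁ N₁ le_rfl)
  have ha0 := ha 0
  -- One step from the ball of radius `R` stays within `R'`, so the estimates for `v` also cover the
  -- first iterate outside the `R`-ball.
  set R' : ℝ := |R| + a 0 * (c * (1 + |R|)) + 1 with hR'
  have hadd : 0 ≤ a 0 * (c * (1 + |R|)) := by positivity
  obtain ⟨C, hC, hv1, hv2⟩ := hvreg R' (by positivity)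
  set D : ℝ := C * (1 + Q) with hD
  set K : ℝ := C * (c * (1 + |R|)) * (1 + Q) with hK
  have hD0 : 0 ≤ D := by positivity
  have hK0 : 0 ≤ K := by positivity
  obtain ⟨N₂, hN₂⟩ := exists_forall_norm_sum_Ico_le hasq.hasSum.tendsto_sum_nat
    (show 0 < ε / (2 * (K + 1)) by positivity)
  have hlim : ∀ᶠ n in atTop, a n ^ 2 < (ε / (4 * (D + 1))) ^ 2 :=
    hasq.tendsto_atTop_zero.eventually_lt_const (by positivity)
  obtain ⟨N₃, hN₃⟩ := eventually_atTop.1 hlim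
  refine ⟨max N₁ (max N₂ N₃), fun n hn m hm hR => ?_⟩
  simp only [ge_iff_le, max_le_iff] at hn
  obtain ⟨hn1, hn2, hn3⟩ := hn
  have hRR' : ∀ k, ‖θ k‖ ≤ R → ‖θ k‖ ≤ R' ∧ ‖θ (k + 1)‖ ≤ R' ∧
      ‖θ (k + 1) - θ k‖ ≤ a k * (c * (1 + |R|)) := by
    intro k hk
    have h1 : ‖θ k‖ ≤ |R| := hk.trans (le_abs_self R)
    have h2 : ‖θ (k + 1) - θ k‖ ≤ a k * (c * (1 + |R|)) := by
      refine (hθ k).trans ?_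
      have := ha k
      gcongr
    have h3 : a k * (c * (1 + |R|)) ≤ a 0 * (c * (1 + |R|)) := by
      have := hanti (Nat.zero_le k)
      gcongr
    have h4 : ‖θ (k + 1)‖ ≤ ‖θ (k + 1) - θ k‖ + ‖θ k‖ := by
      simpa using norm_add_le (θ (k + 1) - θ k) (θ k)
    exact ⟨by linarith, by linarith, h2⟩
  have hvD : ∀ k, n ≤ k → ∀ z, ‖z‖ ≤ R' → ‖v z (Y k)‖ ≤ D := by
    intro k hk z hz
    refine (hv1 z (Y k) hz).trans ?_
    have := hN₁ k (hn1.trans hk)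
    rw [hD]
    gcongr
  -- Up to two boundary terms, the sum consists of step-size decrements, telescoping to `D * (a n -
  -- a m)`, and parameter changes in `v`, each costing `K * a k ^ 2`.
  have main : ∀ m ≥ n, (∀ k ∈ Finset.Ico n m, ‖θ k‖ ≤ R) →
      ‖∑ k ∈ Finset.Ico n m, a k • (v (θ k) (Y k) - v (θ k) (Y (k + 1))) - a n • v (θ n) (Y n) +
        a m • v (θ m) (Y m)‖ ≤ D * (a n - a m) + K * ∑ k ∈ Finset.Ico n m, a k ^ 2 := by
    intro m hm
    induction m, hm using Nat.le_induction with
    | base => intro _; simp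
    | succ m hm ih =>
      intro hR
      have ih' := ih fun k hk => hR k (Finset.Ico_subset_Ico_right m.le_succ hk)
      obtain ⟨h1, h2, h3⟩ := hRR' m (hR m (Finset.mem_Ico.2 ⟨hm, m.lt_succ_self⟩))
      rw [Finset.sum_Ico_succ_top hm, Finset.sum_Ico_succ_top hm]
      have ham := ha m
      have e1 : ‖(a m - a (m + 1)) • v (θ (m + 1)) (Y (m + 1))‖ ≤ D * (a m - a (m + 1)) := by
        have h4 : 0 ≤ a m - a (m + 1) := sub_nonneg.2 (hanti m.le_succ)
        rw [norm_smul, Real.norm_of_nonneg h4, mul_comm]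
        exact mul_le_mul_of_nonneg_right (hvD _ (hm.trans m.le_succ) _ h2) h4
      have e2 : ‖a m • (v (θ (m + 1)) (Y (m + 1)) - v (θ m) (Y (m + 1)))‖ ≤ K * a m ^ 2 := by
        rw [norm_smul, Real.norm_of_nonneg ham]
        have h5 := hN₁ (m + 1) (hn1.trans (hm.trans m.le_succ))
        calc a m * ‖v (θ (m + 1)) (Y (m + 1)) - v (θ m) (Y (m + 1))‖
            ≤ a m * (C * ‖θ (m + 1) - θ m‖ * (1 + ‖Y (m + 1)‖)) := by
              gcongr
              exact hv2 _ _ _ h2 h1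
          _ ≤ a m * (C * (a m * (c * (1 + |R|))) * (1 + Q)) := by gcongr
          _ = K * a m ^ 2 := by rw [hK]; ring
      set S := ∑ k ∈ Finset.Ico n m, a k • (v (θ k) (Y k) - v (θ k) (Y (k + 1)))
      have hdec : S + a m • (v (θ m) (Y m) - v (θ m) (Y (m + 1))) - a n • v (θ n) (Y n) +
          a (m + 1) • v (θ (m + 1)) (Y (m + 1)) =
          (S - a n • v (θ n) (Y n) + a m • v (θ m) (Y m)) -
          (a m - a (m + 1)) • v (θ (m + 1)) (Y (m + 1)) +
          a m • (v (θ (m + 1)) (Y (m + 1)) - v (θ m) (Y (m + 1))) := by module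
      rw [hdec]
      refine (norm_add_le _ _).trans ((add_le_add (norm_sub_le _ _) le_rfl).trans ?_)
      linarith
  rcases hm.eq_or_lt with rfl | hlt
  · simpa using hε.le
  have h1 := main m hm hR
  have hmem : ∀ k, n ≤ k → ‖θ k‖ ≤ R' → ‖a k • v (θ k) (Y k)‖ ≤ D * a k := by
    intro k hk hk'
    rw [norm_smul, Real.norm_of_nonneg (ha k), mul_comm]
    exact mul_le_mul_of_nonneg_right (hvD k hk _ hk') (ha k)
  have h2 := hmem n le_rfl (hRR' n (hR n (Finset.mem_Ico.2 ⟨le_rfl, hlt⟩))).1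
  have h3 := hmem m hm (by
    obtain ⟨j, rfl⟩ : ∃ j, m = j + 1 := ⟨m - 1, by omega⟩
    exact (hRR' j (hR j (Finset.mem_Ico.2 ⟨by omega, by omega⟩))).2.1)
  set S := ∑ k ∈ Finset.Ico n m, a k • (v (θ k) (Y k) - v (θ k) (Y (k + 1)))
  have h4 : ‖S‖ ≤ ‖S - a n • v (θ n) (Y n) + a m • v (θ m) (Y m)‖ + ‖a n • v (θ n) (Y n)‖ +
      ‖a m • v (θ m) (Y m)‖ := by
    have e : S = (S - a n • v (θ n) (Y n) + a m • v (θ m) (Y m)) + a n • v (θ n) (Y n) -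
        a m • v (θ m) (Y m) := by abel
    conv_lhs => rw [e]
    exact (norm_sub_le _ _).trans (add_le_add (norm_add_le _ _) le_rfl)
  have h5 : K * ∑ k ∈ Finset.Ico n m, a k ^ 2 ≤ ε / 2 := by
    have h6 := (le_abs_self _).trans (hN₂ n hn2 m hm)
    calc K * ∑ k ∈ Finset.Ico n m, a k ^ 2 ≤ (K + 1) * (ε / (2 * (K + 1))) := by
          gcongr
          linarith
      _ = ε / 2 := by field_simp
  -- The boundary terms `D * a n` and `D * a m` plus `D * (a n - a m)` add up to `2 * D * a n`.
  have h6 : 2 * D * a n ≤ ε / 2 := by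
    have h7 : a n ≤ ε / (4 * (D + 1)) := (lt_of_pow_lt_pow_left₀ 2 (by positivity) (hN₃ n hn3)).le
    have := ha n
    calc 2 * D * a n ≤ 2 * (D + 1) * (ε / (4 * (D + 1))) := by gcongr; linarith
      _ = ε / 2 := by field_simp; ring
  linarith

/-- A family of measurable functions that is locally Lipschitz in the parameter is jointly
measurable. -/
theorem measurable_uncurry_of_locally_lipschitz {d : ℕ}
    {v : EuclideanSpace ℝ (Fin d) → EuclideanSpace ℝ (Fin d) → EuclideanSpace ℝ (Fin d)}
    (hvmeas : ∀ z, Measurable (v z))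
    (hvlip : ∀ R : ℝ, 0 < R → ∃ C : ℝ, ∀ z z' x, ‖z‖ ≤ R → ‖z'‖ ≤ R →
      ‖v z x - v z' x‖ ≤ C * ‖z - z'‖ * (1 + ‖x‖)) :
    Measurable (Function.uncurry v) := by
  refine measurable_uncurry_of_continuous_of_measurable (fun x => ?_) hvmeas
  rw [continuous_iff_continuousAt]
  intro z
  obtain ⟨C, hC⟩ := hvlip (‖z‖ + 1) (by positivity)
  have hev : ∀ᶠ y in 𝓝 z, ‖y‖ ≤ ‖z‖ + 1 :=
    (continuous_norm.tendsto z).eventually_le_const (by linarith)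
  have hcont : Tendsto (fun y => C * ‖y - z‖ * (1 + ‖x‖)) (𝓝 z) (𝓝 0) := by
    have : Continuous fun y : EuclideanSpace ℝ (Fin d) => C * ‖y - z‖ * (1 + ‖x‖) := by fun_prop
    simpa using this.tendsto z
  rw [ContinuousAt, tendsto_iff_norm_sub_tendsto_zero]
  refine squeeze_zero' (Eventually.of_forall fun y => norm_nonneg _) ?_ hcont
  filter_upwards [hev] with y hy
  exact hC y z x hy (by linarith)

theorem memLp_two_and_integral_norm_sq_le {Ω E : Type*} [MeasurableSpace Ω]
    {P : Measure Ω} [NormedAddCommGroup E] {X : Ω → E}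
    (hX : AEStronglyMeasurable X P) {b : ℝ≥0} (hb : ∫⁻ ω, ‖X ω‖ₑ ^ 2 ∂P ≤ b) :
    MemLp X 2 P ∧ ∫ ω, ‖X ω‖ ^ 2 ∂P ≤ b := by
  constructor
  · refine ⟨hX, ?_⟩
    rw [eLpNorm_lt_top_iff_lintegral_rpow_enorm_lt_top (by simp) (by simp)]
    simpa using hb.trans_lt ENNReal.coe_lt_top
  · rw [integral_eq_lintegral_of_nonneg_ae (ae_of_all _ fun ω => sq_nonneg _)
      (hX.norm.pow 2)]
    refine ENNReal.toReal_le_of_le_ofReal b.2 (le_trans (le_of_eq ?_) (hb.trans (by simp)))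
    refine lintegral_congr fun ω => ?_
    rw [ENNReal.ofReal_pow (norm_nonneg _), ofReal_norm]

/-! ### The truncated martingale noise. -/

section Noise

variable {Ω : Type*} [mΩ : MeasurableSpace Ω] {P : Measure Ω} [IsProbabilityMeasure P]

/-- The martingale part of the noise, cut off where the iterates are large, is summable against
the step sizes. -/
theorem ae_exists_tendsto_sum_martingale_noise {d : ℕ} {ℱ : Filtration ℕ mΩ}
    {θ Y M : ℕ → Ω → EuclideanSpace ℝ (Fin d)}
    {kern : EuclideanSpace ℝ (Fin d) →
      Kernel (EuclideanSpace ℝ (Fin d)) (EuclideanSpace ℝ (Fin d))}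
    [∀ z, IsMarkovKernel (kern z)]
    {v : EuclideanSpace ℝ (Fin d) → EuclideanSpace ℝ (Fin d) → EuclideanSpace ℝ (Fin d)}
    {a : ℕ → ℝ}
    (hθ : ∀ n, StronglyMeasurable[ℱ n] (θ n)) (hY : ∀ n, StronglyMeasurable[ℱ n] (Y n))
    (hM : IsMartingaleDifference P ℱ M)
    (hmarkov : ∀ n, ∀ A : Set (EuclideanSpace ℝ (Fin d)), MeasurableSet A →
      P⟦Y (n + 1) ⁻¹' A | ℱ n⟧ =ᵐ[P] fun ω => (kern (θ n ω) (Y n ω)).real A)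
    (hasq : Summable fun n => a n ^ 2)
    {K' : ℝ} (hMgrowth : ∀ n, ∀ᵐ ω ∂P, ‖M (n + 1) ω‖ ≤ K' * (1 + ‖θ n ω‖))
    (hv : Measurable (Function.uncurry v)) {R C : ℝ} (hC : 0 ≤ C) (hR : 0 ≤ R)
    (hvC : ∀ z x, ‖z‖ ≤ R → ‖v z x‖ ≤ C * (1 + ‖x‖))
    {b : ℝ≥0} {n₀ : ℕ} (hYmom : ∀ n ≥ n₀, ∫⁻ ω, ‖Y n ω‖ₑ ^ 2 ∂P ≤ b) :
    ∀ᵐ ω ∂P, ∃ w : ℕ → EuclideanSpace ℝ (Fin d), ∃ s,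
      Tendsto (fun N => ∑ n ∈ Finset.range N, a n • w n) atTop (𝓝 s) ∧
      ∀ n ≥ n₀, ‖θ n ω‖ ≤ R → w n = M (n + 1) ω + v (θ n ω) (Y (n + 1) ω) -
        ∫ x, v (θ n ω) x ∂(kern (θ n ω) (Y n ω)) := by
  -- The cutoff is known at time `n`, so it preserves the martingale property. It also discards
  -- indices below `n₀`, where the second moment of `Y` is not controlled.
  set A : ℕ → Set Ω := fun n => {ω | ‖θ n ω‖ ≤ R ∧ n₀ ≤ n} with hA
  have hAm : ∀ n, MeasurableSet[ℱ n] (A n) := by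
    intro n
    have h1 : MeasurableSet[ℱ n] {ω | ‖θ n ω‖ ≤ R} :=
      (hθ n).norm.measurable measurableSet_Iic
    exact @MeasurableSet.inter _ (ℱ n) _ _ h1 (@MeasurableSet.const _ (ℱ n) _)
  set Z₁ : ℕ → Ω → EuclideanSpace ℝ (Fin d) := fun n => (A n).indicator (M (n + 1)) with hZ₁
  set g : ℕ → Ω × EuclideanSpace ℝ (Fin d) → EuclideanSpace ℝ (Fin d) := fun n =>
    (Prod.fst ⁻¹' A n).indicator fun p => v (θ n p.1) p.2 with hg
  have hgm : ∀ n, StronglyMeasurable[(ℱ n).prod inferInstance] (g n) := by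
    intro n
    have h1 : @Measurable (Ω × EuclideanSpace ℝ (Fin d)) _ ((ℱ n).prod inferInstance) _
        (fun p => v (θ n p.1) p.2) :=
      hv.comp (((hθ n).measurable.comp measurable_fst).prodMk measurable_snd)
    exact (h1.indicator (measurable_fst (hAm n))).stronglyMeasurable
  set Z₂ : ℕ → Ω → EuclideanSpace ℝ (Fin d) := fun n ω => g n (ω, Y (n + 1) ω) with hZ₂
  have hZ₁m : ∀ n, StronglyMeasurable[ℱ (n + 1)] (Z₁ n) := fun n =>
    (hM.stronglyMeasurable n).indicator (ℱ.mono n.le_succ _ (hAm n))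
  have hZ₂m : ∀ n, StronglyMeasurable[ℱ (n + 1)] (Z₂ n) := by
    intro n
    have h1 : @Measurable Ω (Ω × EuclideanSpace ℝ (Fin d)) (ℱ (n + 1))
        ((ℱ n).prod inferInstance) (fun ω => (ω, Y (n + 1) ω)) :=
      Measurable.prodMk (fun s hs => ℱ.mono n.le_succ s hs) (hY (n + 1)).measurable
    exact ((hgm n).measurable.comp h1).stronglyMeasurable
  have hZ₁b : ∀ n, ∀ᵐ ω ∂P, ‖Z₁ n ω‖ ≤ |K'| * (1 + R) := by
    intro n
    filter_upwards [hMgrowth n] with ω hω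
    by_cases hωA : ω ∈ A n
    · have : Z₁ n ω = M (n + 1) ω := indicator_of_mem hωA _
      rw [this]
      refine hω.trans ?_
      have := hωA.1
      have := le_abs_self K'
      gcongr
    · have : Z₁ n ω = 0 := indicator_of_notMem hωA _
      rw [this, norm_zero]
      positivity
  have hZ₂b : ∀ n ω, n₀ ≤ n → ‖Z₂ n ω‖ ≤ C * (1 + ‖Y (n + 1) ω‖) := by
    intro n ω hn
    by_cases hωA : ω ∈ A n
    · have : Z₂ n ω = v (θ n ω) (Y (n + 1) ω) := indicator_of_mem (by exact hωA) _
      rw [this]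
      exact hvC _ _ hωA.1
    · have : Z₂ n ω = 0 := indicator_of_notMem (by exact hωA) _
      rw [this, norm_zero]
      positivity
  have hZ0 : ∀ n, n < n₀ → Z₁ n = 0 ∧ Z₂ n = 0 := by
    intro n hn
    have : A n = ∅ := by
      ext ω
      simp [hA, hn]
    constructor
    · ext1 ω; simp [hZ₁, this]
    · ext1 ω; simp [hZ₂, hg, this]
  set B : ℝ := |K'| * (1 + R) + C with hB
  have hB0 : 0 ≤ B := by positivity
  have hZ₁2 : ∀ n, MemLp (Z₁ n) 2 P := fun n =>
    MemLp.of_bound ((hZ₁m n).mono (ℱ.le _)).aestronglyMeasurable _ (hZ₁b n)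
  have hY2 : ∀ n ≥ n₀, MemLp (Y n) 2 P ∧ ∫ ω, ‖Y n ω‖ ^ 2 ∂P ≤ b := fun n hn =>
    memLp_two_and_integral_norm_sq_le ((hY n).mono (ℱ.le _)).aestronglyMeasurable (hYmom n hn)
  have hZ₂2 : ∀ n, MemLp (Z₂ n) 2 P := by
    intro n
    rcases lt_or_ge n n₀ with hn | hn
    · rw [(hZ0 n hn).2]
      exact MemLp.zero
    · have h1 : MemLp (fun ω => C * (1 + ‖Y (n + 1) ω‖)) 2 P :=
        ((memLp_const (1 : ℝ)).add (hY2 (n + 1) (by omega)).1.norm).const_mul C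
      refine h1.mono ((hZ₂m n).mono (ℱ.le _)).aestronglyMeasurable (ae_of_all _ fun ω => ?_)
      exact (hZ₂b n ω hn).trans (le_abs_self _)
  have hbound : ∀ n, ∫ ω, ‖(Z₁ n + Z₂ n) ω‖ ^ 2 ∂P ≤ 2 * B ^ 2 + 2 * C ^ 2 * b := by
    intro n
    rcases lt_or_ge n n₀ with hn | hn
    · rw [(hZ0 n hn).1, (hZ0 n hn).2]
      simp
      positivity
    · obtain ⟨h1, h2⟩ := hY2 (n + 1) (by omega)
      have hi : Integrable (fun ω => 2 * C ^ 2 * ‖Y (n + 1) ω‖ ^ 2) P :=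
        h1.integrable_norm_pow'.const_mul _
      calc ∫ ω, ‖(Z₁ n + Z₂ n) ω‖ ^ 2 ∂P
          ≤ ∫ ω, (2 * B ^ 2 + 2 * C ^ 2 * ‖Y (n + 1) ω‖ ^ 2) ∂P := by
            refine integral_mono_ae ((hZ₁2 n).add (hZ₂2 n)).integrable_norm_pow'
              ((integrable_const _).add hi) ?_
            filter_upwards [hZ₁b n] with ω hω
            have h3 : ‖(Z₁ n + Z₂ n) ω‖ ≤ B + C * ‖Y (n + 1) ω‖ := by
              refine (norm_add_le _ _).trans ?_
              have := hZ₂b n ω hn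
              rw [hB]
              linarith
            have h4 : ‖(Z₁ n + Z₂ n) ω‖ ^ 2 ≤ (B + C * ‖Y (n + 1) ω‖) ^ 2 := by gcongr
            nlinarith [sq_nonneg (B - C * ‖Y (n + 1) ω‖)]
        _ = 2 * B ^ 2 + 2 * C ^ 2 * ∫ ω, ‖Y (n + 1) ω‖ ^ 2 ∂P := by
            rw [integral_add (integrable_const _) hi, integral_const_mul (2 * C ^ 2)]
            simp
        _ ≤ _ := by gcongr
  have hmain := ae_exists_tendsto_sum_smul_sub_condExp (P := P) (ℱ := ℱ) (Z := fun n => Z₁ n + Z₂ n)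
    (fun n => (hZ₁m n).add (hZ₂m n)) (fun n => (hZ₁2 n).add (hZ₂2 n)) hbound hasq
  have hcond : ∀ᵐ ω ∂P, ∀ n, P[Z₁ n + Z₂ n | ℱ n] ω =
      ∫ x, g n (ω, x) ∂(kern (θ n ω) (Y n ω)) := by
    rw [ae_all_iff]
    intro n
    have h1 := condExp_add (m := ℱ n) ((hZ₁2 n).integrable one_le_two)
      ((hZ₂2 n).integrable one_le_two)
    have h2 := condExp_indicator (hM.integrable n) (hAm n)
    have h3 := condExp_ae_eq_integral_of_condExp_indicator
      ((hY (n + 1)).mono (ℱ.le _)).measurable (ℱ.le n) (hmarkov n) (hgm n)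
      ((hZ₂2 n).integrable one_le_two)
    filter_upwards [h1, h2, h3, hM.condExp_eq_zero n] with ω h1 h2 h3 h4
    rw [h1, Pi.add_apply, h2, h3]
    simp [indicator_apply, h4]
  filter_upwards [hmain, hcond] with ω ⟨s, hs⟩ hω
  refine ⟨fun n => (Z₁ n + Z₂ n) ω - P[Z₁ n + Z₂ n | ℱ n] ω, s, hs, fun n hn hRn => ?_⟩
  have hωA : ω ∈ A n := ⟨hRn, hn⟩
  have e1 : Z₁ n ω = M (n + 1) ω := indicator_of_mem hωA _
  have e2 : ∀ x, g n (ω, x) = v (θ n ω) x := fun x => indicator_of_mem (by exact hωA) _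
  have e3 : Z₂ n ω = v (θ n ω) (Y (n + 1) ω) := e2 _
  simp only [hω n, Pi.add_apply, e1, e3, e2]

end Noise

/-! ### Assembly of the main theorem. -/

theorem mainTheorem3 {d : ℕ} {Ω : Type*} [MeasurableSpace Ω]
    (P : Measure Ω) [IsProbabilityMeasure P]
    (ℱ : Filtration ℕ ‹MeasurableSpace Ω›)
    (θ Y M : ℕ → Ω → EuclideanSpace ℝ (Fin d))
    (f : EuclideanSpace ℝ (Fin d) → EuclideanSpace ℝ (Fin d) → EuclideanSpace ℝ (Fin d))
    (kern : EuclideanSpace ℝ (Fin d) →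
      Kernel (EuclideanSpace ℝ (Fin d)) (EuclideanSpace ℝ (Fin d)))
    [∀ z, IsMarkovKernel (kern z)]
    (Γ : EuclideanSpace ℝ (Fin d) → Measure (EuclideanSpace ℝ (Fin d)))
    (v : EuclideanSpace ℝ (Fin d) → EuclideanSpace ℝ (Fin d) → EuclideanSpace ℝ (Fin d))
    (a : ℕ → ℝ)
    (V : EuclideanSpace ℝ (Fin d) → ℝ)
    (G H B : Set (EuclideanSpace ℝ (Fin d)))
    -- the processes and the recursion
    (hθ : ∀ n, StronglyMeasurable[ℱ n] (θ n))
    (hY : ∀ n, StronglyMeasurable[ℱ n] (Y n))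
    (hM : IsMartingaleDifference P ℱ M)
    (hf : ∀ z, Measurable (f z))
    (hrec : ∀ n, ∀ᵐ ω ∂P,
      θ (n + 1) ω = θ n ω + a n • (f (θ n ω) (Y n ω) + M (n + 1) ω))
    -- Markov iterate-dependent noise
    (hmarkov : ∀ n, ∀ A : Set (EuclideanSpace ℝ (Fin d)), MeasurableSet A →
      P⟦Y (n + 1) ⁻¹' A | ℱ n⟧ =ᵐ[P] fun ω => (kern (θ n ω) (Y n ω)).real A)
    -- asymptotic boundedness of the noise
    (hYbdd : ∃ C : ℝ≥0, ∀ᵐ ω ∂P, limsup (fun n => ‖Y n ω‖ₑ) atTop < C)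
    (hYmom : limsup (fun n => ∫⁻ ω, ‖Y n ω‖ₑ ^ 2 ∂P) atTop < ∞)
    -- linear growth of `f`, uniformly in the noise variable
    (hfgrowth : ∃ K : ℝ, ∀ z y, ‖f z y‖ ≤ K * (1 + ‖z‖))
    -- step sizes
    (hapos : ∀ n, 0 < a n)
    (hanti : Antitone a)
    (hasum : Tendsto (fun N => ∑ n ∈ Finset.range N, a n) atTop atTop)
    (hasq : Summable fun n => a n ^ 2)
    (haform : HasStepForm a)
    -- unique invariant probability, and Lipschitz continuity of the mean field
    (hΓprob : ∀ z, IsProbabilityMeasure (Γ z))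
    (hΓinv : ∀ z, (kern z).Invariant (Γ z))
    (hΓuniq : ∀ z, ∀ ν : Measure (EuclideanSpace ℝ (Fin d)),
      IsProbabilityMeasure ν → (kern z).Invariant ν → ν = Γ z)
    (hLip : ∃ L : ℝ≥0, LipschitzWith L (meanField f Γ))
    -- growth of the martingale noise
    (hMgrowth : ∃ K' : ℝ, ∀ n, ∀ᵐ ω ∂P, ‖M (n + 1) ω‖ ≤ K' * (1 + ‖θ n ω‖))
    -- solution of the Poisson equation
    (hvmeas : ∀ z, Measurable (v z))
    (hvint : ∀ z y, Integrable (v z) (kern z y))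
    (hpoisson : ∀ z y, v z y - ∫ x, v z x ∂(kern z y) = f z y - meanField f Γ z)
    -- growth and regularity of the solution
    (hvreg : ∀ R : ℝ, 0 < R → ∃ C : ℝ, 0 < C ∧
      (∀ z x, ‖z‖ ≤ R → ‖v z x‖ ≤ C * (1 + ‖x‖)) ∧
      (∀ z z' x, ‖z‖ ≤ R → ‖z'‖ ≤ R → ‖v z x - v z' x‖ ≤ C * ‖z - z'‖ * (1 + ‖x‖)))
    -- the strict Lyapunov function, the attractor and its neighbourhood
    (hV : IsStrictLyapunov V (meanField f Γ) G H)
    (hBopen : IsOpen B)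
    (hBcompact : IsCompact (closure B))
    (hHB : H ⊆ B)
    (hBG : closure B ⊆ G)
    (hBattr : closure B ⊆ domainOfAttraction (meanField f Γ) H)
    -- `B` is charged at arbitrarily large times, and the conditional probabilities diverge
    (hW1 : ∀ N : ℕ, ∃ n ≥ N, 0 < P (θ n ⁻¹' B))
    (hW2 : ∀ᵐ ω ∂P, Tendsto
      (fun N : ℕ => ∑ n ∈ Finset.range N, (P⟦θ (n + 1) ⁻¹' B | ℱ n⟧) ω) atTop atTop) :
    (∀ᵐ ω ∂P, ∃ C : ℝ, ∀ n, ‖θ n ω‖ ≤ C) ∧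
    (∀ᵐ ω ∂P, Tendsto (fun n => Metric.infEDist (θ n ω) H) atTop (𝓝 0)) := by
  obtain ⟨L, hL⟩ := hLip
  obtain ⟨K, hK⟩ := hfgrowth
  obtain ⟨K', hK'⟩ := hMgrowth
  obtain ⟨Cy, hCy⟩ := hYbdd
  have ha : ∀ n, 0 ≤ a n := fun n => (hapos n).le
  have hv : Measurable (Function.uncurry v) := by
    refine measurable_uncurry_of_locally_lipschitz hvmeas fun R hR => ?_
    obtain ⟨C, -, -, hC⟩ := hvreg R hR
    exact ⟨C, hC⟩
  obtain ⟨b, n₀, hb⟩ : ∃ b : ℝ≥0, ∃ n₀ : ℕ, ∀ n ≥ n₀, ∫⁻ ω, ‖Y n ω‖ₑ ^ 2 ∂P ≤ b := by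
    obtain ⟨b, hb1, hb2⟩ := exists_between hYmom
    lift b to ℝ≥0 using hb2.ne
    obtain ⟨n₀, hn₀⟩ := eventually_atTop.1 (eventually_lt_of_limsup_lt hb1)
    exact ⟨b, n₀, fun n hn => (hn₀ n hn).le⟩
  -- Integer radii suffice and keep the exceptional set null; `R + 1` below supplies a positive
  -- radius even for `R = 0`.
  have hmart : ∀ᵐ ω ∂P, ∀ R : ℕ, ∃ w : ℕ → EuclideanSpace ℝ (Fin d), ∃ s,
      Tendsto (fun N => ∑ n ∈ Finset.range N, a n • w n) atTop (𝓝 s) ∧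
      ∀ n ≥ n₀, ‖θ n ω‖ ≤ R → w n = M (n + 1) ω + v (θ n ω) (Y (n + 1) ω) -
        ∫ x, v (θ n ω) x ∂(kern (θ n ω) (Y n ω)) := by
    rw [ae_all_iff]
    intro R
    obtain ⟨C, hC, hvC, -⟩ := hvreg (R + 1) (by positivity)
    exact ae_exists_tendsto_sum_martingale_noise hθ hY hM hmarkov hasq hK' hv hC.le R.cast_nonneg
      (fun z x hz => hvC z x (by linarith)) hb
  -- Lévy's conditional Borel–Cantelli lemma.
  have hfreq : ∀ᵐ ω ∂P, ∃ᶠ n in atTop, θ n ω ∈ B := by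
    have h1 := ae_mem_limsup_atTop_iff (ℱ := ℱ) P (s := fun n => θ n ⁻¹' B)
      fun n => (hθ n).measurable hBopen.measurableSet
    filter_upwards [h1, hW2] with ω h1 h2
    exact mem_limsup_iff_frequently_mem.1 (h1.2 h2)
  have hconv : ∀ᵐ ω ∂P, ∀ U, IsOpen U → H ⊆ U → ∀ᶠ n in atTop, θ n ω ∈ U := by
    filter_upwards [ae_all_iff.2 hrec, ae_all_iff.2 hK', hCy, hmart, hfreq]
      with ω hrecω hMω hYω hmartω hfreqω U hU hHU
    have hYω' : ∀ᶠ n in atTop, ‖Y n ω‖ ≤ Cy := by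
      filter_upwards [eventually_lt_of_limsup_lt hYω] with n hn
      exact_mod_cast hn.le
    have hstep : ∀ n, ‖θ (n + 1) ω - θ n ω‖ ≤ a n * ((|K| + |K'|) * (1 + ‖θ n ω‖)) := by
      intro n
      rw [hrecω n, add_sub_cancel_left, norm_smul, Real.norm_of_nonneg (ha n)]
      refine mul_le_mul_of_nonneg_left ((norm_add_le _ _).trans ?_) (ha n)
      rw [add_mul]
      refine add_le_add ((hK _ _).trans ?_) ((hMω n).trans ?_)
      · exact mul_le_mul_of_nonneg_right (le_abs_self K) (by positivity)
      · exact mul_le_mul_of_nonneg_right (le_abs_self K') (by positivity)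
    refine hV.eventually_mem_of_frequently_mem hL hBopen hBcompact hHB hBattr
      (θ := fun n => θ n ω)
      (ξ := fun n => f (θ n ω) (Y n ω) + M (n + 1) ω - meanField f Γ (θ n ω))
      ha hasq hasum (fun n => ?_) (fun R ε hε => ?_) hfreqω hU hHU
    · rw [hrecω n, add_sub_cancel]
    · obtain ⟨R', hR'⟩ := exists_nat_ge R
      obtain ⟨w, s, hs, hw⟩ := hmartω R'
      obtain ⟨N₁, hN₁⟩ := exists_forall_norm_sum_Ico_le hs (half_pos hε)
      obtain ⟨N₂, hN₂⟩ := exists_forall_norm_sum_smul_poisson_le hvreg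
        (θ := fun n => θ n ω) (Y := fun n => Y n ω) (c := |K| + |K'|) (Q := Cy)
        ha hanti hasq (by positivity) hstep hYω' R (half_pos hε)
      refine ⟨max n₀ (max N₁ N₂), fun n hn m hm hRm => ?_⟩
      simp only [ge_iff_le, max_le_iff] at hn
      have h1 := hN₁ n hn.2.1 m hm
      have h2 := hN₂ n hn.2.2 m hm hRm
      -- The Poisson equation splits the noise into the martingale part `w` and the part summed by
      -- parts.
      have h3 : ∑ k ∈ Finset.Ico n m,
          a k • (f (θ k ω) (Y k ω) + M (k + 1) ω - meanField f Γ (θ k ω)) =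
          ∑ k ∈ Finset.Ico n m, a k • w k +
          ∑ k ∈ Finset.Ico n m, a k • (v (θ k ω) (Y k ω) - v (θ k ω) (Y (k + 1) ω)) := by
        rw [← Finset.sum_add_distrib]
        refine Finset.sum_congr rfl fun k hk => ?_
        rw [hw k (hn.1.trans (Finset.mem_Ico.1 hk).1) ((hRm k hk).trans hR'), ← smul_add]
        congr 1
        rw [add_sub_right_comm, ← hpoisson]
        generalize ∫ x, v (θ k ω) x ∂(kern (θ k ω) (Y k ω)) = u
        abel
      rw [h3]
      exact (norm_add_le _ _).trans (by linarith)
  constructor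
  -- Boundedness is the case `U = B`; the finitely many earlier iterates do no harm.
  · obtain ⟨ρ, hρ⟩ := hBcompact.isBounded.exists_norm_le
    filter_upwards [hconv] with ω hω
    have hbdd : IsBoundedUnder (· ≤ ·) atTop fun n => ‖θ n ω‖ :=
      ⟨ρ, eventually_map.2 ((hω B hBopen hHB).mono fun n hn => hρ _ (subset_closure hn))⟩
    obtain ⟨C, hC⟩ := hbdd.bddAbove_range
    exact ⟨C, fun n => hC ⟨n, rfl⟩⟩
  · filter_upwards [hconv] with ω hω
    rw [ENNReal.tendsto_nhds_zero]
    intro ε hε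
    obtain ⟨δ, hδ, hδε⟩ := ENNReal.lt_iff_exists_nnreal_btwn.1 hε
    filter_upwards [hω _ (Metric.isOpen_thickening (δ := δ) (E := H))
      (Metric.self_subset_thickening (by exact_mod_cast hδ) H)] with n hn
    have : Metric.infEDist (θ n ω) H < ENNReal.ofReal δ := hn
    rw [ENNReal.ofReal_coe_nnreal] at this
    exact (this.trans hδε).le
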